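/- **Second abstract unobstructedness theorem.** Let $\mathbf{k}$ be a field of characteristic $0$ and let $\Lambda$ be a complete local Noetherian $\mathbf{k}$-algebra with residue field $\mathbf{k}$ and maximal ideal $\mathfrak{m}_\Lambda$. Let $\mathbf{Art}_\Lambda$ be the category of Artinian local $\Lambda$-algebras with residue field $\mathbf{k}$; write $M_A = A\otimes_\Lambda M$ for a $\Lambda$-module $M$ and $A\in\mathbf{Art}_\Lambda$, and write the index $0$ for base change to $A_0=\Lambda/\mathfrak{m}_\Lambda=\mathbf{k}$. Elements of bidegree $(p,q)$ have total degree $|\cdot|=p+q$. A *$\Lambda$-linear curved Batalin–Vilkovisky algebra* of dimension $d\ge 1$ consists of flat and ($\mathfrak m_\Lambda$-adically) complete $\Lambda$-modules $G^{p,q}$, zero unless $-d\le p\le 0$ and $q\ge 0$, with an associative product $\wedge: G^{p,q}\times G^{p',q'}\to G^{p+p',q+q'}$, graded commutative for the total degree, with unit $1\in G^{0,0}$; a $\Lambda$-bilinear bracket $[-,-]: G^{p,q}\times G^{p',q'}\to G^{p+p'+1,q+q'}$ with $[\theta,\xi]=-(-1)^{(|\theta|+1)(|\xi|+1)}[\xi,\theta]$,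 $[\theta,[\xi,\eta]]=[[\theta,\xi],\eta]+(-1)^{(|\theta|+1)(|\xi|+1)}[\xi,[\theta,\eta]]$ and $[\theta,\xi\wedge\eta]=[\theta,\xi]\wedge\eta+(-1)^{(|\theta|+1)|\xi|}\xi\wedge[\theta,\eta]$; a $\Lambda$-linear $\Delta:G^{p,q}\to G^{p+1,q}$ with $\Delta^2=0$ and $(-1)^{|\theta|}[\theta,\xi]=\Delta(\theta\wedge\xi)-\Delta\theta\wedge\xi-(-1)^{|\theta|}\theta\wedge\Delta\xi$; a $\Lambda$-linear predifferential $\bar\partial:G^{p,q}\to G^{p,q+1}$ with $\bar\partial(\theta\wedge\xi)=\bar\partial\theta\wedge\xi+(-1)^{|\theta|}\theta\wedge\bar\partial\xi$ and $\bar\partial[\theta,\xi]=[\bar\partial\theta,\xi]+(-1)^{|\theta|+1}[\theta,\bar\partial\xi]$; and elements $\ell\in\mathfrak m_\Lambda\cdot G^{-1,2}$, $y\in\mathfrak m_\Lambda\cdot G^{0,1}$ with $\bar\partial^2\theta=[\ell,\theta]$, $\bar\partial\ell=0$, $\Delta\bar\partial\theta+\bar\partial\Delta\theta=[y,\theta]$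 and $\bar\partial y+\Delta\ell=0$. Put $\check d=\Delta+\bar\partial+(\ell+y)\wedge(-)$ and $G^n=\bigoplus_{p+q=n}G^{p,q}$. A *$\Lambda$-linear curved Batalin–Vilkovisky calculus* $(G^{\bullet,\bullet},A^{\bullet,\bullet})$ consists moreover of flat and complete $\Lambda$-modules $A^{i,j}$, zero unless $0\le i\le d$ and $j\ge 0$, with an associative, graded commutative bigraded product $\wedge$ with unit $1_A \in A^{0,0}$; a derivation $\partial:A^{i,j}\to A^{i+1,j}$ of $\wedge$ with $\partial^2=0$; a $\Lambda$-bilinear contraction $\lrcorner:G^{p,q}\times A^{i,j}\to A^{p+i,q+j}$ with $1\lrcorner\alpha=\alpha$, $(\theta\wedge\xi)\lrcorner\alpha=\theta\lrcorner(\xi\lrcorner\alpha)$, $\theta\lrcorner(\alpha\wedge\beta)=(\theta\lrcorner\alpha)\wedge\beta$ for $\theta\in G^{0,q}$, and $\theta\lrcorner(\alpha\wedge\beta)=(\theta\lrcorner\alpha)\wedge\beta+(-1)^{|\theta||\alpha|}\alpha\wedge(\theta\lrcorner\beta)$ for $\theta\in G^{-1,q}$; a $\Lambda$-bilinear Lie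 derivative $\mathcal L:G^{p,q}\times A^{i,j}\to A^{p+i+1,q+j}$ with $(-1)^{|\theta|}\mathcal L_\theta\alpha=\partial(\theta\lrcorner\alpha)-(-1)^{|\theta|}\theta\lrcorner\partial\alpha$ and $[\theta,\xi]\lrcorner\alpha=\mathcal L_\theta(\xi\lrcorner\alpha)-(-1)^{(|\theta|+1)|\xi|}\xi\lrcorner\mathcal L_\theta\alpha$; a $\Lambda$-linear $\bar\partial:A^{i,j}\to A^{i,j+1}$ that is a derivation of $\wedge$, with $\bar\partial(\theta\lrcorner\alpha)=\bar\partial\theta\lrcorner\alpha+(-1)^{|\theta|}\theta\lrcorner\bar\partial\alpha$, $\partial\bar\partial+\bar\partial\partial=0$ and $\bar\partial^2\alpha=\mathcal L_\ell\alpha$; and a volume form $\omega\in A^{d,0}$ such that $\theta\mapsto\theta\lrcorner\omega$ is an isomorphism $G^{p,q}\to A^{p+d,q}$ for all $p,q$, $\Delta\theta\lrcorner\omega=\partial(\theta\lrcorner\omega)$ and $\bar\partial\omega=y\lrcorner\omega$. It is *quasi-perfect* if (i) the first spectral sequence (filtration by $p$) of the double complex $(G_0^{\bullet,\bullet},\Delta,\bar\partial)$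 degenerates at $E_1$, and (ii) for every $A\in\mathbf{Art}_\Lambda$ and every $n$, the map $H^n(G_A^\bullet,\check d)\to H^n(G_0^\bullet,\check d)$ induced by $A\to A_0$ is surjective. Let $(G^{\bullet,\bullet},A^{\bullet,\bullet})$ be a quasi-perfect $\Lambda$-linear curved Batalin–Vilkovisky calculus, and let $L^\bullet=G^{-1,\bullet}$ be the associated $\Lambda$-linear curved Lie algebra. Its Maurer–Cartan functor $\mathrm{MC}(L^\bullet,-)$ sends $A\in\mathbf{Art}_\Lambda$ to the set of $\phi\in\mathfrak m_A\cdot L^1_A$ with $\bar\partial\phi+\tfrac12[\phi,\phi]+\ell=0$. Then: 1. $\mathrm{MC}(L^\bullet,-)$ is unobstructed: for every surjection $B'\to B$ in $\mathbf{Art}_\Lambda$, the map $\mathrm{MC}(L^\bullet,B')\to\mathrm{MC}(L^\bullet,B)$ is surjective. 2. For every $A\in\mathbf{Art}_\Lambda$, every $\phi\in\mathrm{MC}(L^\bullet,A)$ extends to a semi-classical Maurer–Cartan solution $(\phi,f)$ over $A$: there is $f\in\mathfrak m_A\cdot G_A^{0,0}$ with $\bar\partial f+[\phi,f]+y+\Delta\phi=0$.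 -/

import Mathlib

open CategoryTheory TensorProduct IsLocalRing

universe w u v v'

noncomputable section

/-! ### Base change of modules -/

namespace BaseChange

variable {Λ : Type u} [CommRing Λ] {M : Type v} [AddCommGroup M] [Module Λ M]

/-- The map `A ⊗ M → B ⊗ M` induced by a homomorphism of `Λ`-algebras `π : A → B`. -/
def map {A B : Type*} [CommRing A] [Algebra Λ A] [CommRing B] [Algebra Λ B]
    (M : Type v) [AddCommGroup M] [Module Λ M] (π : A →ₐ[Λ] B) :
    A ⊗[Λ] M →ₗ[Λ] B ⊗[Λ] M :=
  π.toLinearMap.rTensor M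

lemma map_smul {A B : Type*} [CommRing A] [Algebra Λ A] [CommRing B] [Algebra Λ B]
    (π : A →ₐ[Λ] B) (a : A) (x : A ⊗[Λ] M) : map M π (a • x) = π a • map M π x := by
  induction x using TensorProduct.induction_on with
  | zero => simp
  | tmul b m => simp [map, TensorProduct.smul_tmul']
  | add x y hx hy => simp [smul_add, hx, hy]

lemma map_mem {A B : Type*} [CommRing A] [Algebra Λ A] [CommRing B] [Algebra Λ B]
    (π : A →ₐ[Λ] B) (S : Submodule Λ M) {x : A ⊗[Λ] M} (hx : x ∈ S.baseChange A) :
    map M π x ∈ S.baseChange B := by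
  rw [Submodule.baseChange_eq_span] at hx
  induction hx using Submodule.span_induction with
  | mem x h =>
    obtain ⟨m, hm, rfl⟩ := h
    simpa [map] using Submodule.tmul_mem_baseChange_of_mem (1 : B) hm
  | zero => simp
  | add x y _ _ hx hy => rw [map_add]; exact add_mem hx hy
  | smul a x _ hx => rw [map_smul]; exact Submodule.smul_mem _ _ hx

lemma map_baseChange {A B : Type*} [CommRing A] [Algebra Λ A] [CommRing B] [Algebra Λ B]
    (π : A →ₐ[Λ] B) (f : M →ₗ[Λ] M) (x : A ⊗[Λ] M) :
    map M π (f.baseChange A x) = f.baseChange B (map M π x) := by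
  induction x using TensorProduct.induction_on with
  | zero => simp
  | tmul b m => simp [map]
  | add x y hx hy => simp [hx, hy]

lemma map_bilin {A B : Type*} [CommRing A] [Algebra Λ A] [CommRing B] [Algebra Λ B]
    (π : A →ₐ[Λ] B) (f : M →ₗ[Λ] M →ₗ[Λ] M) (x y : A ⊗[Λ] M) :
    map M π (LinearMap.BilinMap.baseChange A f x y) =
      LinearMap.BilinMap.baseChange B f (map M π x) (map M π y) := by
  induction x using TensorProduct.induction_on with
  | zero => simp
  | add x y hx hy => simp [hx, hy]
  | tmul b m =>
    induction y using TensorProduct.induction_on with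
    | zero => simp
    | add x y hx hy => simp [hx, hy]
    | tmul c n => simp [map]

lemma baseChange_mem {A : Type*} [CommRing A] [Algebra Λ A] (f : M →ₗ[Λ] M)
    {S T : Submodule Λ M} (h : ∀ x ∈ S, f x ∈ T) {x : A ⊗[Λ] M} (hx : x ∈ S.baseChange A) :
    f.baseChange A x ∈ T.baseChange A := by
  rw [Submodule.baseChange_eq_span] at hx
  induction hx using Submodule.span_induction with
  | mem x hx =>
    obtain ⟨m, hm, rfl⟩ := hx
    simpa using Submodule.tmul_mem_baseChange_of_mem (1 : A) (h m hm)
  | zero => simp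
  | add x y _ _ hx hy => rw [_root_.map_add]; exact add_mem hx hy
  | smul a x _ hx => rw [_root_.map_smul]; exact Submodule.smul_mem _ _ hx

lemma algHom_mem_maximalIdeal {A B : Type*} [CommRing A] [Algebra Λ A] [CommRing B] [Algebra Λ B]
    [IsLocalRing A] [IsArtinianRing A] [IsLocalRing B] (π : A →ₐ[Λ] B) {a : A}
    (ha : a ∈ maximalIdeal A) : π a ∈ maximalIdeal B := by
  have h1 : IsNilpotent (maximalIdeal A) := by
    rw [← IsLocalRing.jacobson_eq_maximalIdeal (⊥ : Ideal A) bot_ne_top]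
    exact IsArtinianRing.isNilpotent_jacobson_bot (R := A)
  obtain ⟨n, hn⟩ := h1
  have h2 : a ^ n = 0 := by
    have := Ideal.pow_mem_pow ha n
    rwa [hn] at this
  have h3 : π a ^ n = 0 := by rw [← map_pow, h2, _root_.map_zero]
  rw [mem_maximalIdeal]
  intro hu
  exact (hu.pow n).ne_zero h3

lemma map_mem_maximalIdeal_smul {A B : Type*} [CommRing A] [Algebra Λ A] [CommRing B]
    [Algebra Λ B] [IsLocalRing A] [IsArtinianRing A] [IsLocalRing B] (π : A →ₐ[Λ] B)
    (S : Submodule Λ M) {x : A ⊗[Λ] M} (hx : x ∈ maximalIdeal A • S.baseChange A) :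
    map M π x ∈ maximalIdeal B • S.baseChange B := by
  induction hx using Submodule.smul_induction_on' with
  | smul a ha y hy =>
    rw [map_smul]
    exact Submodule.smul_mem_smul (algHom_mem_maximalIdeal π ha) (map_mem π S hy)
  | add x _ y _ hx hy => rw [_root_.map_add]; exact add_mem hx hy

/-- Elements of `𝔪 M` vanish in `Λ/𝔪 ⊗ M`. -/
lemma residue_tmul_eq_zero [IsLocalRing Λ] {m : M}
    (hm : m ∈ maximalIdeal Λ • (⊤ : Submodule Λ M)) (a : ResidueField Λ) :
    a ⊗ₜ[Λ] m = 0 := by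
  induction hm using Submodule.smul_induction_on' with
  | smul r hr y _ =>
    have h : r • a = 0 := by
      rw [Algebra.smul_def, show algebraMap Λ (ResidueField Λ) r = 0 from
        (residue_eq_zero_iff r).mpr hr, zero_mul]
    rw [TensorProduct.tmul_smul, TensorProduct.smul_tmul', h, TensorProduct.zero_tmul]
  | add x _ y _ hx hy => rw [TensorProduct.tmul_add, hx, hy, add_zero]

end BaseChange

/-! ### Subquotients -/

section Subquotient

variable {R : Type*} [CommRing R] {V W : Type*} [AddCommGroup V] [Module R V] [AddCommGroup W]
  [Module R W]

/-- The module `Z / (Z ∩ B)` for submodules `Z` and `B` of `V`. -/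
def Subquotient (Z B : Submodule R V) : Type _ := Z ⧸ B.submoduleOf Z

instance (Z B : Submodule R V) : AddCommGroup (Subquotient Z B) :=
  inferInstanceAs (AddCommGroup (Z ⧸ B.submoduleOf Z))

instance (Z B : Submodule R V) : Module R (Subquotient Z B) :=
  inferInstanceAs (Module R (Z ⧸ B.submoduleOf Z))

/-- The map on subquotients induced by a linear map. -/
def Subquotient.map {Z B : Submodule R V} {Z' B' : Submodule R W} (f : V →ₗ[R] W)
    (hZ : ∀ x ∈ Z, f x ∈ Z') (hB : ∀ x ∈ B, f x ∈ B') : Subquotient Z B →ₗ[R] Subquotient Z' B' :=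
  Submodule.mapQ (B.submoduleOf Z) (B'.submoduleOf Z') (f.restrict hZ) fun x hx => hB x.1 hx

end Subquotient

/-! ### Functors of Artin rings -/

/-- The objects of `Art_Λ`: Artinian local `Λ`-algebras `A` with residue field `k`, i.e. such that
`k → Λ → A → A/𝔪_A` is bijective. -/
structure ArtAlg (k : Type w) (Λ : Type u) [Field k] [CommRing Λ] [Algebra k Λ] where
  carrier : Type u
  [commRing : CommRing carrier]
  [algebra : Algebra Λ carrier]
  [isLocalRing : IsLocalRing carrier]
  [isArtinianRing : IsArtinianRing carrier]
  residue_bijective : Function.Bijective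
    ((algebraMap Λ (ResidueField carrier)).comp (algebraMap k Λ))

attribute [instance] ArtAlg.commRing ArtAlg.algebra ArtAlg.isLocalRing ArtAlg.isArtinianRing

namespace ArtAlg

variable {k : Type w} {Λ : Type u} [Field k] [CommRing Λ] [Algebra k Λ]

/-- Morphisms are homomorphisms of `Λ`-algebras; they are automatically local, see
`BaseChange.algHom_mem_maximalIdeal`. -/
instance : Category (ArtAlg k Λ) where
  Hom A B := A.carrier →ₐ[Λ] B.carrier
  id A := AlgHom.id Λ A.carrier
  comp f g := AlgHom.comp g f

lemma surjective_algebraMap_residueField (A : ArtAlg k Λ) :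
    Function.Surjective (algebraMap Λ (ResidueField A.carrier)) := fun x => by
  obtain ⟨c, hc⟩ := A.residue_bijective.2 x
  exact ⟨algebraMap k Λ c, hc⟩

/-- The (unique) homomorphism of `Λ`-algebras `A → A₀ = Λ/𝔪_Λ`: the reduction `A → A/𝔪_A`,
followed by the inverse of the isomorphism `Λ/𝔪_Λ ≅ A/𝔪_A`. -/
def toResidue [IsLocalRing Λ] (A : ArtAlg k Λ) : A.carrier →ₐ[Λ] ResidueField Λ :=
  let e : (Λ ⧸ maximalIdeal Λ) ≃ₐ[Λ] ResidueField A.carrier :=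
    (Ideal.quotientEquivAlgOfEq Λ (by
      have h := RingHom.ker_isMaximal_of_surjective _ A.surjective_algebraMap_residueField
      exact (eq_maximalIdeal h).symm)).trans
    (Ideal.quotientKerAlgEquivOfSurjective
      (f := Algebra.ofId Λ (ResidueField A.carrier)) A.surjective_algebraMap_residueField)
  (e.symm : ResidueField A.carrier →ₐ[Λ] (Λ ⧸ maximalIdeal Λ)).comp
    (IsScalarTower.toAlgHom Λ A.carrier (ResidueField A.carrier))

end ArtAlg

/-- A functor on `Art_Λ` is unobstructed if it maps surjections of rings to surjections. -/
def IsUnobstructed {k : Type w} {Λ : Type u} [Field k] [CommRing Λ] [Algebra k Λ]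
    (F : ArtAlg k Λ ⥤ Type v) : Prop :=
  ∀ ⦃B' B : ArtAlg k Λ⦄ (π : B'.carrier →ₐ[Λ] B.carrier), Function.Surjective π →
    Function.Surjective (F.map (X := B') (Y := B) π)

/-! ### Curved Lie algebras and the Maurer-Cartan functor -/

/-- The structure of a `Λ`-linear curved Lie algebra on the `Λ`-module `L = ⨁ᵢ Lⁱ`. -/
structure CurvedLieAlgebra (Λ : Type u) [CommRing Λ] [IsLocalRing Λ]
    (L : Type v) [AddCommGroup L] [Module Λ L] where
  /-- the homogeneous parts `Lⁱ` -/
  gr : ℤ → Submodule Λ L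
  isInternal : DirectSum.IsInternal gr
  flat : ∀ i, Module.Flat Λ (gr i)
  complete : ∀ i, IsAdicComplete (maximalIdeal Λ) (gr i)
  /-- the Lie bracket -/
  bracket : L →ₗ[Λ] L →ₗ[Λ] L
  bracket_mem : ∀ {i j : ℤ} {a b : L}, a ∈ gr i → b ∈ gr j → bracket a b ∈ gr (i + j)
  bracket_antisymm : ∀ {i j : ℤ} {a b : L}, a ∈ gr i → b ∈ gr j →
    bracket a b = -((i * j).negOnePow • bracket b a)
  jacobi : ∀ {i j l : ℤ} {a b c : L}, a ∈ gr i → b ∈ gr j → c ∈ gr l →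
    bracket a (bracket b c) = bracket (bracket a b) c + (i * j).negOnePow • bracket b (bracket a c)
  /-- the predifferential `∂̄` -/
  dbar : L →ₗ[Λ] L
  dbar_mem : ∀ {i : ℤ} {a : L}, a ∈ gr i → dbar a ∈ gr (i + 1)
  dbar_bracket : ∀ {i j : ℤ} {a b : L}, a ∈ gr i → b ∈ gr j →
    dbar (bracket a b) = bracket (dbar a) b + i.negOnePow • bracket a (dbar b)
  /-- the curvature `ℓ` -/
  ell : L
  ell_mem : ell ∈ maximalIdeal Λ • gr 2
  dbar_dbar : ∀ a, dbar (dbar a) = bracket ell a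
  dbar_ell : dbar ell = 0

namespace CurvedLieAlgebra

variable {Λ : Type u} [CommRing Λ] [IsLocalRing Λ] {L : Type v} [AddCommGroup L] [Module Λ L]

/-- The solutions `φ ∈ 𝔪_A · L_A¹` of the extended Maurer-Cartan equation
`∂̄φ + ½[φ, φ] + ℓ = 0` over `A`. -/
def mcSet (k : Type w) [Field k] [Algebra k Λ] (X : CurvedLieAlgebra Λ L) (A : ArtAlg k Λ) :
    Set (A.carrier ⊗[Λ] L) :=
  {φ | φ ∈ maximalIdeal A.carrier • (X.gr 1).baseChange A.carrier ∧
    X.dbar.baseChange A.carrier φ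
      + algebraMap k Λ (1 / 2) • LinearMap.BilinMap.baseChange A.carrier X.bracket φ φ
      + 1 ⊗ₜ[Λ] X.ell = 0}

/-- The map from solutions over `A` to solutions over `B` induced by `π : A → B`. -/
def mcMap (k : Type w) [Field k] [Algebra k Λ] (X : CurvedLieAlgebra Λ L) {A B : ArtAlg k Λ}
    (π : A.carrier →ₐ[Λ] B.carrier) (φ : X.mcSet k A) : X.mcSet k B :=
  ⟨BaseChange.map L π φ.1, BaseChange.map_mem_maximalIdeal_smul π _ φ.2.1, by
    have h := congrArg (BaseChange.map L π) φ.2.2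
    rw [map_add, map_add, map_smul, BaseChange.map_baseChange, BaseChange.map_bilin,
      map_zero] at h
    simpa [BaseChange.map] using h⟩

/-- The Maurer-Cartan functor `MC(L, -)` on `Art_Λ`. -/
def MC (k : Type w) [Field k] [Algebra k Λ] (X : CurvedLieAlgebra Λ L) :
    ArtAlg k Λ ⥤ Type (max u v) where
  obj A := X.mcSet k A
  map π := ↾(X.mcMap k π)
  map_id A := by
    ext φ
    exact (LinearMap.rTensor_id_apply L A.carrier φ.1)
  map_comp {A B C} f g := by
    ext φ
    exact (LinearMap.rTensor_comp_apply L (AlgHom.toLinearMap g)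
      (AlgHom.toLinearMap f) φ.1)

end CurvedLieAlgebra

/-! ### The spectral sequence of a filtered complex -/

/-- A complex of `R`-modules with a decreasing filtration, given inside one `R`-module `V`:
`F p n` is the `p`-th step of the filtration of the part of degree `n`. -/
structure FilteredComplex (R : Type u) [CommRing R] (V : Type v) [AddCommGroup V] [Module R V] where
  F : ℤ → ℤ → Submodule R V
  antitone : ∀ {p p' : ℤ} (n : ℤ), p ≤ p' → F p' n ≤ F p n
  D : V →ₗ[R] V
  D_mem : ∀ {p n : ℤ} {x : V}, x ∈ F p n → D x ∈ F p (n + 1)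
  D_D : ∀ x, D (D x) = 0

namespace FilteredComplex

variable {R : Type u} [CommRing R] {V : Type v} [AddCommGroup V] [Module R V]
  (C : FilteredComplex R V)

/-- `Z_r^p = {x ∈ F^p | Dx ∈ F^{p+r}}`, in degree `n`. -/
def Z (r p n : ℤ) : Submodule R V := C.F p n ⊓ (C.F (p + r) (n + 1)).comap C.D

/-- `B_r^p = D Z_{r-1}^{p-r+1} + Z_{r-1}^{p+1}`, in degree `n`. -/
def B (r p n : ℤ) : Submodule R V :=
  (C.Z (r - 1) (p - r + 1) (n - 1)).map C.D ⊔ C.Z (r - 1) (p + 1) n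

/-- The term `E_r^{p, n-p} = Z_r^p / B_r^p`, where `n` is the total degree. -/
abbrev E (r p n : ℤ) : Type v := Subquotient (C.Z r p n) (C.B r p n)

lemma D_mem_Z {r p n : ℤ} {x : V} (hx : x ∈ C.Z r p n) : C.D x ∈ C.Z r (p + r) (n + 1) := by
  refine ⟨hx.2, ?_⟩
  change C.D (C.D x) ∈ C.F (p + r + r) (n + 1 + 1)
  rw [C.D_D]
  exact zero_mem _

lemma D_mem_B {r p n : ℤ} {x : V} (hx : x ∈ C.B r p n) : C.D x ∈ C.B r (p + r) (n + 1) := by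
  obtain ⟨y, hy, z, hz, rfl⟩ := Submodule.mem_sup.mp hx
  obtain ⟨w, _, rfl⟩ := hy
  rw [map_add, C.D_D, zero_add]
  refine Submodule.mem_sup_left (Submodule.mem_map_of_mem ?_)
  rwa [show p + r - r + 1 = p + 1 by ring, show n + 1 - 1 = n by ring]

/-- The differential `d_r : E_r^{p, n-p} → E_r^{p+r, n+1-p-r}` induced by `D`. -/
def d (r p n : ℤ) : C.E r p n →ₗ[R] C.E r (p + r) (n + 1) :=
  Subquotient.map C.D (fun _ hx => C.D_mem_Z hx) (fun _ hx => C.D_mem_B hx)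

/-- The spectral sequence degenerates at `E₁`: all differentials `d_r` with `r ≥ 1` vanish. -/
def DegeneratesAtE1 : Prop := ∀ r p n : ℤ, 1 ≤ r → C.d r p n = 0

end FilteredComplex

/-! ### Curved Batalin-Vilkovisky algebras -/

/-- The structure of a `Λ`-linear curved Batalin-Vilkovisky algebra of dimension `d` on the
`Λ`-module `G = ⨁ G^{p,q}`. Signs are governed by the total degree `p + q`. -/
structure CurvedBVAlgebra (Λ : Type u) [CommRing Λ] [IsLocalRing Λ] (d : ℕ)
    (G : Type v) [AddCommGroup G] [Module Λ G] where
  one_le_dim : 1 ≤ d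
  /-- the homogeneous parts `G^{p,q}` -/
  gr : ℤ → ℤ → Submodule Λ G
  isInternal : DirectSum.IsInternal fun i : ℤ × ℤ => gr i.1 i.2
  gr_eq_bot : ∀ p q : ℤ, ¬ (-(d : ℤ) ≤ p ∧ p ≤ 0 ∧ 0 ≤ q) → gr p q = ⊥
  flat : ∀ p q, Module.Flat Λ (gr p q)
  complete : ∀ p q, IsAdicComplete (maximalIdeal Λ) (gr p q)
  /-- the product `∧` -/
  mul : G →ₗ[Λ] G →ₗ[Λ] G
  mul_mem : ∀ {p q p' q' : ℤ} {a b : G}, a ∈ gr p q → b ∈ gr p' q' →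
    mul a b ∈ gr (p + p') (q + q')
  mul_assoc : ∀ a b c, mul (mul a b) c = mul a (mul b c)
  mul_comm : ∀ {p q p' q' : ℤ} {a b : G}, a ∈ gr p q → b ∈ gr p' q' →
    mul a b = ((p + q) * (p' + q')).negOnePow • mul b a
  /-- the unit -/
  one : G
  one_mem : one ∈ gr 0 0
  one_mul : ∀ a, mul one a = a
  /-- the Lie bracket -/
  bracket : G →ₗ[Λ] G →ₗ[Λ] G
  bracket_mem : ∀ {p q p' q' : ℤ} {a b : G}, a ∈ gr p q → b ∈ gr p' q' →
    bracket a b ∈ gr (p + p' + 1) (q + q')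
  bracket_antisymm : ∀ {p q p' q' : ℤ} {a b : G}, a ∈ gr p q → b ∈ gr p' q' →
    bracket a b = -(((p + q + 1) * (p' + q' + 1)).negOnePow • bracket b a)
  jacobi : ∀ {p q p' q' p'' q'' : ℤ} {a b c : G}, a ∈ gr p q → b ∈ gr p' q' → c ∈ gr p'' q'' →
    bracket a (bracket b c) =
      bracket (bracket a b) c + ((p + q + 1) * (p' + q' + 1)).negOnePow • bracket b (bracket a c)
  bracket_mul : ∀ {p q p' q' p'' q'' : ℤ} {a b c : G},
    a ∈ gr p q → b ∈ gr p' q' → c ∈ gr p'' q'' →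
    bracket a (mul b c) =
      mul (bracket a b) c + ((p + q + 1) * (p' + q')).negOnePow • mul b (bracket a c)
  /-- the Batalin-Vilkovisky operator `Δ` -/
  Del : G →ₗ[Λ] G
  Del_mem : ∀ {p q : ℤ} {a : G}, a ∈ gr p q → Del a ∈ gr (p + 1) q
  Del_Del : ∀ a, Del (Del a) = 0
  bracket_eq : ∀ {p q p' q' : ℤ} {a b : G}, a ∈ gr p q → b ∈ gr p' q' →
    (p + q).negOnePow • bracket a b =
      Del (mul a b) - mul (Del a) b - (p + q).negOnePow • mul a (Del b)
  /-- the predifferential `∂̄` -/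
  dbar : G →ₗ[Λ] G
  dbar_mem : ∀ {p q : ℤ} {a : G}, a ∈ gr p q → dbar a ∈ gr p (q + 1)
  dbar_mul : ∀ {p q p' q' : ℤ} {a b : G}, a ∈ gr p q → b ∈ gr p' q' →
    dbar (mul a b) = mul (dbar a) b + (p + q).negOnePow • mul a (dbar b)
  dbar_bracket : ∀ {p q p' q' : ℤ} {a b : G}, a ∈ gr p q → b ∈ gr p' q' →
    dbar (bracket a b) = bracket (dbar a) b + (p + q + 1).negOnePow • bracket a (dbar b)
  /-- the curvature `ℓ` -/
  ell : G
  ell_mem : ell ∈ maximalIdeal Λ • gr (-1) 2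
  dbar_dbar : ∀ a, dbar (dbar a) = bracket ell a
  dbar_ell : dbar ell = 0
  /-- the element `y` -/
  y : G
  y_mem : y ∈ maximalIdeal Λ • gr 0 1
  Del_dbar : ∀ a, Del (dbar a) + dbar (Del a) = bracket y a
  Del_ell : Del ell + dbar y = 0

namespace CurvedBVAlgebra

variable {Λ : Type u} [CommRing Λ] [IsLocalRing Λ] {d : ℕ} {G : Type v} [AddCommGroup G]
  [Module Λ G] (X : CurvedBVAlgebra Λ d G)

/-! #### The curved Lie algebra `L = G^{-1,•}` -/

/-- The submodule `L = ⨁_q G^{-1,q}` of `G`. -/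
def L : Submodule Λ G := ⨆ q, X.gr (-1) q

lemma gr_le_L (q : ℤ) : X.gr (-1) q ≤ X.L := le_iSup (X.gr (-1)) q

lemma bracket_mem_L {a b : G} (ha : a ∈ X.L) (hb : b ∈ X.L) : X.bracket a b ∈ X.L := by
  refine Submodule.iSup_induction (X.gr (-1)) (motive := fun a => X.bracket a b ∈ X.L) ha
    (fun q a ha => ?_) (by simp) (fun x y hx hy => by simpa using add_mem hx hy)
  refine Submodule.iSup_induction (X.gr (-1)) (motive := fun b => X.bracket a b ∈ X.L) hb
    (fun q' b hb => ?_) (by simp) (fun x y hx hy => by simpa using add_mem hx hy)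
  exact X.gr_le_L (q + q') (X.bracket_mem ha hb)

lemma dbar_mem_L {a : G} (ha : a ∈ X.L) : X.dbar a ∈ X.L := by
  refine Submodule.iSup_induction (X.gr (-1)) (motive := fun a => X.dbar a ∈ X.L) ha
    (fun q a ha => ?_) (by simp) (fun x y hx hy => by simpa using add_mem hx hy)
  exact X.gr_le_L (q + 1) (X.dbar_mem ha)

lemma ell_mem_L : X.ell ∈ X.L := X.gr_le_L 2 (Submodule.smul_le_right X.ell_mem)

lemma isInternal_L : DirectSum.IsInternal fun q => (X.gr (-1) q).submoduleOf X.L := by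
  rw [DirectSum.isInternal_submodule_iff_iSupIndep_and_iSup_eq_top]
  have hmap : ∀ q, ((X.gr (-1) q).submoduleOf X.L).map X.L.subtype = X.gr (-1) q := fun q => by
    rw [Submodule.submoduleOf, Submodule.map_comap_subtype, inf_eq_right.mpr (X.gr_le_L q)]
  constructor
  · have h := X.isInternal.submodule_iSupIndep
    have h2 : iSupIndep (X.gr (-1)) :=
      h.comp (f := fun q : ℤ => ((-1 : ℤ), q)) (fun a b hab => by simpa using hab)
    rw [iSupIndep_def] at h2 ⊢
    intro q
    have h3 := h2 q
    rw [Submodule.disjoint_def] at h3 ⊢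
    intro x hx hx'
    apply Subtype.ext
    refine h3 x.1 hx ?_
    have h4 := Submodule.mem_map_of_mem (f := X.L.subtype) hx'
    simp only [Submodule.map_iSup, hmap] at h4
    exact h4
  · apply Submodule.map_injective_of_injective X.L.injective_subtype
    rw [Submodule.map_iSup, Submodule.map_top, Submodule.range_subtype]
    simp only [hmap]
    rfl

/-- Completeness only depends on the module up to isomorphism. -/
lemma isAdicComplete_of_equiv {R M N : Type*} [CommRing R] [AddCommGroup M] [AddCommGroup N]
    [Module R M] [Module R N] (e : M ≃ₗ[R] N) (I : Ideal R) (h : IsAdicComplete I M) :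
    IsAdicComplete I N := by
  have key : ∀ (n : ℕ) (x y : M), x ≡ y [SMOD (I ^ n • ⊤ : Submodule R M)] ↔
      e x ≡ e y [SMOD (I ^ n • ⊤ : Submodule R N)] := fun n x y => by
    rw [SModEq.sub_mem, SModEq.sub_mem, ← map_sub,
      show (I ^ n • ⊤ : Submodule R N) = (I ^ n • ⊤ : Submodule R M).map (e : M →ₗ[R] N) by
        rw [Submodule.map_smul'', Submodule.map_top, LinearEquiv.range]]
    exact (Function.Injective.mem_set_image e.injective).symm
  refine { haus' := fun x hx => ?_, prec' := fun f hf => ?_ }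
  · have := h.toIsHausdorff.haus' (e.symm x) fun n => (key n _ _).mpr (by simpa using hx n)
    simpa using this
  · obtain ⟨l, hl⟩ := h.toIsPrecomplete.prec' (fun n => e.symm (f n))
      fun {m n} hmn => (key m _ _).mpr (by simpa using hf hmn)
    exact ⟨e l, fun n => by simpa using (key n _ _).mp (hl n)⟩

/-- The `Λ`-linear curved Lie algebra `L = G^{-1,•}`. -/
def lie : CurvedLieAlgebra Λ X.L where
  gr q := (X.gr (-1) q).submoduleOf X.L
  isInternal := X.isInternal_L
  flat q :=
    have := X.flat (-1) q
    Module.Flat.of_linearEquiv (Submodule.submoduleOfEquivOfLe (X.gr_le_L q))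
  complete q := isAdicComplete_of_equiv (Submodule.submoduleOfEquivOfLe (X.gr_le_L q)).symm _
    (X.complete (-1) q)
  bracket := LinearMap.mk₂ Λ (fun a b => ⟨X.bracket a b, X.bracket_mem_L a.2 b.2⟩)
    (fun _ _ _ => Subtype.ext (by simp)) (fun _ _ _ => Subtype.ext (by simp))
    (fun _ _ _ => Subtype.ext (by simp)) (fun _ _ _ => Subtype.ext (by simp))
  bracket_mem ha hb := X.bracket_mem ha hb
  bracket_antisymm {i j a b} ha hb := Subtype.ext (by
    have h := X.bracket_antisymm ha hb
    rwa [show (-1 + i + 1) * (-1 + j + 1) = i * j by ring] at h)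
  jacobi {i j l a b c} ha hb hc := Subtype.ext (by
    have h := X.jacobi ha hb hc
    rwa [show (-1 + i + 1) * (-1 + j + 1) = i * j by ring] at h)
  dbar := X.dbar.restrict fun _ ha => X.dbar_mem_L ha
  dbar_mem ha := X.dbar_mem ha
  dbar_bracket {i j a b} ha hb := Subtype.ext (by
    have h := X.dbar_bracket ha hb
    rwa [show -1 + i + 1 = i by ring] at h)
  ell := ⟨X.ell, X.ell_mem_L⟩
  ell_mem := by
    have h : X.ell ∈ (maximalIdeal Λ • (X.gr (-1) 2).submoduleOf X.L).map X.L.subtype := by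
      rw [Submodule.map_smul'', Submodule.submoduleOf, Submodule.map_comap_subtype,
        inf_eq_right.mpr (X.gr_le_L 2)]
      exact X.ell_mem
    obtain ⟨z, hz, hz'⟩ := h
    rwa [show (⟨X.ell, X.ell_mem_L⟩ : X.L) = z from Subtype.ext hz'.symm]
  dbar_dbar a := Subtype.ext (X.dbar_dbar a)
  dbar_ell := Subtype.ext X.dbar_ell

/-! #### Semi-classical Maurer-Cartan solutions -/

/-- The semi-classical Maurer-Cartan solutions over `A`: pairs `(φ, f)` with
`φ ∈ 𝔪_A · G_A^{-1,1}`, `f ∈ 𝔪_A · G_A^{0,0}`, `∂̄φ + ½[φ, φ] + ℓ = 0` and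
`∂̄f + [φ, f] + y + Δφ = 0`. -/
def smcSet (k : Type w) [Field k] [Algebra k Λ] (A : ArtAlg k Λ) :
    Set ((A.carrier ⊗[Λ] G) × (A.carrier ⊗[Λ] G)) :=
  {s | s.1 ∈ maximalIdeal A.carrier • (X.gr (-1) 1).baseChange A.carrier ∧
    s.2 ∈ maximalIdeal A.carrier • (X.gr 0 0).baseChange A.carrier ∧
    X.dbar.baseChange A.carrier s.1
      + algebraMap k Λ (1 / 2) • LinearMap.BilinMap.baseChange A.carrier X.bracket s.1 s.1
      + 1 ⊗ₜ[Λ] X.ell = 0 ∧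
    X.dbar.baseChange A.carrier s.2
      + LinearMap.BilinMap.baseChange A.carrier X.bracket s.1 s.2
      + 1 ⊗ₜ[Λ] X.y + X.Del.baseChange A.carrier s.1 = 0}

/-! #### Quasi-perfectness -/

lemma bracket_mem_smul_top {e : G} (he : e ∈ maximalIdeal Λ • (⊤ : Submodule Λ G)) (a : G) :
    X.bracket e a ∈ maximalIdeal Λ • (⊤ : Submodule Λ G) := by
  induction he using Submodule.smul_induction_on' with
  | smul r hr z _ =>
    rw [map_smul, LinearMap.smul_apply]
    exact Submodule.smul_mem_smul hr trivial
  | add x _ z _ hx hz => rw [map_add, LinearMap.add_apply]; exact add_mem hx hz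

/-- The double complex `(G₀^{•,•}, Δ, ∂̄)` over `A₀ = Λ/𝔪_Λ`, as a filtered complex: its total
complex with differential `Δ + ∂̄`, filtered by the first degree `p`. -/
def filteredComplexZero : FilteredComplex (ResidueField Λ) (ResidueField Λ ⊗[Λ] G) where
  F p n := (⨆ (p' : ℤ) (_ : p ≤ p'), X.gr p' (n - p')).baseChange (ResidueField Λ)
  antitone {p p'} n h := Submodule.baseChange_mono _
    (iSup₂_le fun i hi => le_iSup₂_of_le i (h.trans hi) le_rfl)
  D := (X.Del + X.dbar).baseChange (ResidueField Λ)
  D_mem {p n x} hx := by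
    refine BaseChange.baseChange_mem _ (fun a ha => ?_) hx
    revert a
    change (⨆ (p' : ℤ) (_ : p ≤ p'), X.gr p' (n - p')) ≤
      (⨆ (p' : ℤ) (_ : p ≤ p'), X.gr p' (n + 1 - p')).comap (X.Del + X.dbar)
    refine iSup₂_le fun i hi a ha => ?_
    have h1 : X.Del a ∈ X.gr (i + 1) (n + 1 - (i + 1)) := by
      have h := X.Del_mem ha
      rwa [show n - i = n + 1 - (i + 1) by ring] at h
    have h2 : X.dbar a ∈ X.gr i (n + 1 - i) := by
      have h := X.dbar_mem ha
      rwa [show n - i + 1 = n + 1 - i by ring] at h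
    exact add_mem
      (le_iSup₂_of_le (f := fun (p' : ℤ) (_ : p ≤ p') => X.gr p' (n + 1 - p')) (i + 1)
        (by omega) le_rfl h1)
      (le_iSup₂_of_le (f := fun (p' : ℤ) (_ : p ≤ p') => X.gr p' (n + 1 - p')) i hi le_rfl h2)
  D_D x := by
    induction x using TensorProduct.induction_on with
    | zero => simp
    | add x z hx hz => rw [map_add, map_add, hx, hz, add_zero]
    | tmul c a =>
      rw [LinearMap.baseChange_tmul, LinearMap.baseChange_tmul]
      apply BaseChange.residue_tmul_eq_zero
      have h : (X.Del + X.dbar) ((X.Del + X.dbar) a) = X.bracket X.y a + X.bracket X.ell a := by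
        rw [← X.Del_dbar, ← X.dbar_dbar]
        simp only [LinearMap.add_apply, map_add, X.Del_Del]
        abel
      rw [h]
      exact add_mem
        (X.bracket_mem_smul_top (Submodule.smul_mono le_rfl le_top X.y_mem) a)
        (X.bracket_mem_smul_top (Submodule.smul_mono le_rfl le_top X.ell_mem) a)

/-- The part `G^n = ⨁_{p+q=n} G^{p,q}` of total degree `n`. -/
def tot (n : ℤ) : Submodule Λ G := ⨆ p, X.gr p (n - p)

/-- The operator `ď = Δ + ∂̄ + (ℓ + y) ∧ (-)`. -/
def dcheck : G →ₗ[Λ] G := X.Del + X.dbar + X.mul (X.ell + X.y)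

/-- The cocycles `{x ∈ G_A^n | ďx = 0}`. -/
def cocycles (A : Type*) [CommRing A] [Algebra Λ A] (n : ℤ) : Submodule Λ (A ⊗[Λ] G) :=
  ((X.tot n).baseChange A ⊓ LinearMap.ker (X.dcheck.baseChange A)).restrictScalars Λ

/-- The coboundaries `ď(G_A^{n-1})`. -/
def coboundaries (A : Type*) [CommRing A] [Algebra Λ A] (n : ℤ) : Submodule Λ (A ⊗[Λ] G) :=
  (((X.tot (n - 1)).baseChange A).map (X.dcheck.baseChange A)).restrictScalars Λ

/-- The cohomology `H^n(G_A^•, ď)`. -/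
abbrev H (A : Type*) [CommRing A] [Algebra Λ A] (n : ℤ) : Type _ :=
  Subquotient (X.cocycles A n) (X.coboundaries A n)

lemma map_mem_cocycles {A B : Type*} [CommRing A] [Algebra Λ A] [CommRing B] [Algebra Λ B]
    (π : A →ₐ[Λ] B) {n : ℤ} {x : A ⊗[Λ] G} (hx : x ∈ X.cocycles A n) :
    BaseChange.map G π x ∈ X.cocycles B n := by
  refine ⟨BaseChange.map_mem π _ hx.1, ?_⟩
  have h : X.dcheck.baseChange A x = 0 := hx.2
  change X.dcheck.baseChange B (BaseChange.map G π x) = 0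
  rw [← BaseChange.map_baseChange, h, map_zero]

lemma map_mem_coboundaries {A B : Type*} [CommRing A] [Algebra Λ A] [CommRing B] [Algebra Λ B]
    (π : A →ₐ[Λ] B) {n : ℤ} {x : A ⊗[Λ] G} (hx : x ∈ X.coboundaries A n) :
    BaseChange.map G π x ∈ X.coboundaries B n := by
  obtain ⟨z, hz, rfl⟩ := hx
  exact ⟨BaseChange.map G π z, BaseChange.map_mem π _ hz, (BaseChange.map_baseChange π _ z).symm⟩

/-- The map `H^n(G_A^•, ď) → H^n(G_B^•, ď)` induced by `π : A → B`. -/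
def mapH {A B : Type*} [CommRing A] [Algebra Λ A] [CommRing B] [Algebra Λ B]
    (π : A →ₐ[Λ] B) (n : ℤ) : X.H A n →ₗ[Λ] X.H B n :=
  Subquotient.map (BaseChange.map G π) (fun _ hx => X.map_mem_cocycles π hx)
    (fun _ hx => X.map_mem_coboundaries π hx)

/-- Quasi-perfectness: the first spectral sequence of the double complex `(G₀^{•,•}, Δ, ∂̄)`
degenerates at `E₁`, and `H^n(G_A^•, ď) → H^n(G₀^•, ď)` is surjective for all `A` and `n`. -/
def IsQuasiPerfect (k : Type w) [Field k] [Algebra k Λ] : Prop :=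
  X.filteredComplexZero.DegeneratesAtE1 ∧
    ∀ (A : ArtAlg k Λ) (n : ℤ), Function.Surjective (X.mapH A.toResidue n)

end CurvedBVAlgebra

/-! ### Curved Batalin-Vilkovisky calculi -/

/-- The structure of a `Λ`-linear curved Batalin-Vilkovisky calculus of dimension `d` on the
`Λ`-modules `G = ⨁ G^{p,q}` and `Ω = ⨁ A^{i,j}`. Signs are governed by the total degree. The rules
`𝓛_[θ,ξ] = [𝓛_θ, 𝓛_ξ]`, `𝓛_(θ∧ξ) α = (-1)^|ξ| 𝓛_θ(ξ ⌟ α) + θ ⌟ 𝓛_ξ α` and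
`∂̄(𝓛_θ α) = 𝓛_(∂̄θ) α + (-1)^(|θ|+1) 𝓛_θ(∂̄α)` follow from those listed. -/
structure CurvedBVCalculus (Λ : Type u) [CommRing Λ] [IsLocalRing Λ] (d : ℕ)
    (G : Type v) [AddCommGroup G] [Module Λ G] (Ω : Type v') [AddCommGroup Ω] [Module Λ Ω]
    extends CurvedBVAlgebra Λ d G where
  /-- the homogeneous parts `A^{i,j}` -/
  grΩ : ℤ → ℤ → Submodule Λ Ω
  isInternalΩ : DirectSum.IsInternal fun i : ℤ × ℤ => grΩ i.1 i.2
  grΩ_eq_bot : ∀ i j : ℤ, ¬ (0 ≤ i ∧ i ≤ (d : ℤ) ∧ 0 ≤ j) → grΩ i j = ⊥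
  flatΩ : ∀ i j, Module.Flat Λ (grΩ i j)
  completeΩ : ∀ i j, IsAdicComplete (maximalIdeal Λ) (grΩ i j)
  /-- the product `∧` -/
  mulΩ : Ω →ₗ[Λ] Ω →ₗ[Λ] Ω
  mulΩ_mem : ∀ {i j i' j' : ℤ} {α β : Ω}, α ∈ grΩ i j → β ∈ grΩ i' j' →
    mulΩ α β ∈ grΩ (i + i') (j + j')
  mulΩ_assoc : ∀ α β γ, mulΩ (mulΩ α β) γ = mulΩ α (mulΩ β γ)
  mulΩ_comm : ∀ {i j i' j' : ℤ} {α β : Ω}, α ∈ grΩ i j → β ∈ grΩ i' j' →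
    mulΩ α β = ((i + j) * (i' + j')).negOnePow • mulΩ β α
  /-- the unit -/
  oneΩ : Ω
  oneΩ_mem : oneΩ ∈ grΩ 0 0
  oneΩ_mul : ∀ α, mulΩ oneΩ α = α
  /-- the de Rham differential `∂` -/
  del : Ω →ₗ[Λ] Ω
  del_mem : ∀ {i j : ℤ} {α : Ω}, α ∈ grΩ i j → del α ∈ grΩ (i + 1) j
  del_del : ∀ α, del (del α) = 0
  del_mul : ∀ {i j i' j' : ℤ} {α β : Ω}, α ∈ grΩ i j → β ∈ grΩ i' j' →
    del (mulΩ α β) = mulΩ (del α) β + (i + j).negOnePow • mulΩ α (del β)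
  /-- the contraction `⌟` -/
  contr : G →ₗ[Λ] Ω →ₗ[Λ] Ω
  contr_mem : ∀ {p q i j : ℤ} {θ : G} {α : Ω}, θ ∈ gr p q → α ∈ grΩ i j →
    contr θ α ∈ grΩ (p + i) (q + j)
  one_contr : ∀ α, contr one α = α
  mul_contr : ∀ θ ξ α, contr (mul θ ξ) α = contr θ (contr ξ α)
  /-- elements of `G^{0,q}` act by operators that are linear over `A^{•,•}` -/
  contr_mulΩ_zero : ∀ {q : ℤ} {θ : G}, θ ∈ gr 0 q → ∀ α β,
    contr θ (mulΩ α β) = mulΩ (contr θ α) β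
  /-- elements of `G^{-1,q}` act by derivations of total degree `q - 1` -/
  contr_mulΩ_neg_one : ∀ {q i j i' j' : ℤ} {θ : G} {α β : Ω},
    θ ∈ gr (-1) q → α ∈ grΩ i j → β ∈ grΩ i' j' →
    contr θ (mulΩ α β) =
      mulΩ (contr θ α) β + ((-1 + q) * (i + j)).negOnePow • mulΩ α (contr θ β)
  /-- the Lie derivative `𝓛` -/
  lieD : G →ₗ[Λ] Ω →ₗ[Λ] Ω
  lieD_mem : ∀ {p q i j : ℤ} {θ : G} {α : Ω}, θ ∈ gr p q → α ∈ grΩ i j →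
    lieD θ α ∈ grΩ (p + i + 1) (q + j)
  /-- the homotopy formula `(-1)^|θ| 𝓛_θ α = ∂(θ ⌟ α) - (-1)^|θ| θ ⌟ ∂α` -/
  lieD_eq : ∀ {p q : ℤ} {θ : G}, θ ∈ gr p q → ∀ α,
    (p + q).negOnePow • lieD θ α = del (contr θ α) - (p + q).negOnePow • contr θ (del α)
  /-- the mixed Leibniz rule `[θ, ξ] ⌟ α = 𝓛_θ(ξ ⌟ α) - (-1)^((|θ|+1)|ξ|) ξ ⌟ 𝓛_θ α` -/
  bracket_contr : ∀ {p q p' q' : ℤ} {θ ξ : G}, θ ∈ gr p q → ξ ∈ gr p' q' → ∀ α,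
    contr (bracket θ ξ) α =
      lieD θ (contr ξ α) - ((p + q + 1) * (p' + q')).negOnePow • contr ξ (lieD θ α)
  /-- the predifferential `∂̄` -/
  dbarΩ : Ω →ₗ[Λ] Ω
  dbarΩ_mem : ∀ {i j : ℤ} {α : Ω}, α ∈ grΩ i j → dbarΩ α ∈ grΩ i (j + 1)
  dbarΩ_mul : ∀ {i j i' j' : ℤ} {α β : Ω}, α ∈ grΩ i j → β ∈ grΩ i' j' →
    dbarΩ (mulΩ α β) = mulΩ (dbarΩ α) β + (i + j).negOnePow • mulΩ α (dbarΩ β)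
  dbarΩ_contr : ∀ {p q : ℤ} {θ : G}, θ ∈ gr p q → ∀ α,
    dbarΩ (contr θ α) = contr (dbar θ) α + (p + q).negOnePow • contr θ (dbarΩ α)
  del_dbarΩ : ∀ α, del (dbarΩ α) + dbarΩ (del α) = 0
  dbarΩ_dbarΩ : ∀ α, dbarΩ (dbarΩ α) = lieD ell α
  /-- the volume form `ω` -/
  vol : Ω
  vol_mem : vol ∈ grΩ d 0
  /-- `κ : G^{p,q} → A^{p+d,q}`, `θ ↦ θ ⌟ ω`, is an isomorphism -/
  bijOn_contr_vol : ∀ p q : ℤ,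
    Set.BijOn (fun θ => contr θ vol) (gr p q : Set G) (grΩ (p + d) q : Set Ω)
  Del_contr_vol : ∀ θ, contr (Del θ) vol = del (contr θ vol)
  dbarΩ_vol : dbarΩ vol = contr y vol

end

noncomputable section

/-! Put `φ` and `f` together into one element `a = φ + f` of total degree `0`, with curvature `S =
(Δ + ∂̄)a + ½[a, a] + ℓ + y`. Since `G^{p,q}` vanishes for `p > 0`, the component of `S` in bidegree
`(-1, 2)` is the Maurer-Cartan expression of `φ`, and the component in bidegree `(0, 1)` is the
semi-classical one (`curvature_add`). The commutator of `ď` with `a ∧` is `[a, -] + (Δ + ∂̄)a ∧`,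
whose commutator with `a ∧` is `[a, a] ∧`, which commutes with `a ∧`. Exponentiating, `ď(e^a) = e^a
∧ S`; the denominators `n!` are where characteristic `0` enters.

Let `ε` be killed by `𝔪_A` and suppose that `S` vanishes modulo `ε`. Then `S ∈ ε G_A ≅ G_0` by
flatness, so `a ∧ S = 0` and `ď(e^a) = S` (`exists_dcheck_eq_curvature`). Hence `e^a` is a cocycle
modulo `ε`. Condition (ii) of quasi-perfectness propagates to the lifting of cocycles along every
surjection (`IsQuasiPerfect.exists_cocycle_lift`), and the difference between `e^a` and a cocycle
over `A` lifting its reduction is `ε x` with `x` over the residue field. So `S = ε · ďx`: the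
obstruction is exact for `Δ + ∂̄` on `G_0` (`IsQuasiPerfect.exists_smallMap_dcheck_eq`).

An arbitrary `x` of total degree `0` is not an admissible correction. Degeneration at `E₁` makes the
differential strict for the filtration by `p` (`DegeneratesAtE1.exists_primitive`), so `x` may be
moved into the filtration step that contains `S`. In general this is step `-1`, which gives `x = ψ +
g` of bidegrees `(-1, 1)` and `(0, 0)`, and subtracting `ε ψ` and `ε g` solves both equations. If
`φ` already solves its equation, `S` lies in step `0`, only `g` occurs, and `φ` is left unchanged.

Induction over small extensions then extends every `φ` to a pair
(`IsQuasiPerfect.exists_smcCurv_eq_zero`) and lifts pairs along surjections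
(`IsQuasiPerfect.exists_lift_smc`). Unobstructedness of `φ` alone follows by extending it to a pair,
lifting the pair and forgetting `f`. -/

lemma Subquotient.exists_sub_mem_of_surjective {R V W : Type*} [CommRing R] [AddCommGroup V]
    [Module R V] [AddCommGroup W] [Module R W] {Z B : Submodule R V} {Z' B' : Submodule R W}
    {f : V →ₗ[R] W} {hZ : ∀ x ∈ Z, f x ∈ Z'} {hB : ∀ x ∈ B, f x ∈ B'}
    (h : Function.Surjective (Subquotient.map f hZ hB)) {x : W} (hx : x ∈ Z') :
    ∃ z ∈ Z, f z - x ∈ B' := by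
  obtain ⟨q, hq⟩ := h (Submodule.Quotient.mk (p := B'.submoduleOf Z') ⟨x, hx⟩)
  obtain ⟨z, rfl⟩ := Submodule.Quotient.mk_surjective (B.submoduleOf Z) q
  have h2 : Submodule.Quotient.mk (p := B'.submoduleOf Z') ⟨f z.1, hZ _ z.2⟩ =
      Submodule.Quotient.mk ⟨x, hx⟩ := hq
  have h3 := (Submodule.Quotient.eq _).mp h2
  exact ⟨z.1, z.2, h3⟩

/-! ### Strictness of filtered complexes whose spectral sequence degenerates -/

namespace FilteredComplex

variable {R : Type u} [CommRing R] {V : Type v} [AddCommGroup V] [Module R V]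
  {C : FilteredComplex R V}

lemma DegeneratesAtE1.D_mem_B (h : C.DegeneratesAtE1) {r p n : ℤ} (hr : 1 ≤ r) {x : V}
    (hx : x ∈ C.Z r p n) : C.D x ∈ C.B r (p + r) (n + 1) := by
  have h1 : C.d r p n (Submodule.Quotient.mk (p := (C.B r p n).submoduleOf (C.Z r p n)) ⟨x, hx⟩)
      = 0 := by
    rw [h r p n hr]; rfl
  have h2 : Submodule.Quotient.mk (p := (C.B r (p + r) (n + 1)).submoduleOf (C.Z r (p + r) (n + 1)))
      ⟨C.D x, C.D_mem_Z hx⟩ = 0 := h1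
  have h3 := (Submodule.Quotient.mk_eq_zero _).mp h2
  exact h3

/-- If the spectral sequence degenerates, an exact element of `F^q` with a primitive in `F^p`,
`p < q`, has a primitive in `F^{p+1}`. -/
lemma DegeneratesAtE1.exists_primitive_succ (h : C.DegeneratesAtE1) {p n : ℤ} (N : ℕ) :
    ∀ {q : ℤ}, p < q → C.F (q + N) (n + 1) = ⊥ → ∀ {x : V}, x ∈ C.F p n →
      C.D x ∈ C.F q (n + 1) → ∃ z ∈ C.F (p + 1) n, C.D z = C.D x := by
  induction N with
  | zero =>
    intro q _ hbot x _ hDx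
    rw [Nat.cast_zero, add_zero] at hbot
    rw [hbot, Submodule.mem_bot] at hDx
    exact ⟨0, zero_mem _, by rw [map_zero, hDx]⟩
  | succ N ih =>
    intro q hpq hbot x hx hDx
    have hxZ : x ∈ C.Z (q - p) p n :=
      ⟨hx, by change C.D x ∈ C.F (p + (q - p)) (n + 1); rwa [show p + (q - p) = q by ring]⟩
    -- Vanishing of `d_{q-p}` on the class of `x` gives `Dx = Dz + t` with `z ∈ F^{p+1}` and `t ∈
    -- F^{q+1}`. Then `x - z` has differential one step deeper, closer to the step where the
    -- filtration is zero.
    have h1 := h.D_mem_B (by omega) hxZ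
    obtain ⟨_, ⟨z, hz, rfl⟩, t, ht, hzt⟩ := Submodule.mem_sup.mp h1
    have hz' : z ∈ C.F (p + 1) n := by
      have := hz.1
      rwa [show p + (q - p) - (q - p) + 1 = p + 1 by ring, show n + 1 - 1 = n by ring] at this
    have ht' : t ∈ C.F (q + 1) (n + 1) := by
      have := ht.1
      rwa [show p + (q - p) + 1 = q + 1 by ring] at this
    have hD : C.D (x - z) = t := by rw [map_sub, ← hzt]; abel
    obtain ⟨z', hz'1, hz'2⟩ := ih (q := q + 1) (by omega)
      (by rw [← hbot]; congr 1; push_cast; ring)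
      (sub_mem hx (C.antitone n (by omega) hz')) (by rwa [hD])
    exact ⟨z + z', add_mem hz' hz'1, by rw [map_add, hz'2, map_sub]; abel⟩

/-- Strictness of the differential: `D(F^p) ∩ F^q = D(F^q)` for `p ≤ q`. -/
theorem DegeneratesAtE1.exists_primitive (h : C.DegeneratesAtE1) {n q : ℤ} (N : ℕ)
    (hbot : C.F (q + N) (n + 1) = ⊥) (m : ℕ) : ∀ {x : V}, x ∈ C.F (q - m) n →
      C.D x ∈ C.F q (n + 1) → ∃ z ∈ C.F q n, C.D z = C.D x := by
  induction m with
  | zero => exact fun {x} hx _ => ⟨x, by simpa using hx, rfl⟩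
  | succ m ih =>
    intro x hx hDx
    obtain ⟨z, hz, hzx⟩ := h.exists_primitive_succ N (by push_cast; omega) hbot hx hDx
    obtain ⟨z', hz', hzz'⟩ := ih
      (by rwa [show q - (m + 1 : ℕ) + 1 = q - m by push_cast; ring] at hz) (by rwa [hzx])
    exact ⟨z', hz', hzz'.trans hzx⟩

end FilteredComplex

/-! ### Exponentials of nilpotent operators -/

section Exponential

variable {R : Type*} [Ring R] {D T U W : R}

/-- Moving `D` to the right past a factor `T` leaves a `U`, and moving that `U` past a later factor
leaves a `W`, which moves freely. The coefficients count choices of one and of two factors; the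
exponent `n + 2` avoids truncated subtraction. -/
lemma mul_pow_of_commutators (hDT : D * T = T * D + U) (hUT : U * T = T * U + W)
    (hWT : W * T = T * W) (n : ℕ) :
    D * T ^ (n + 2) =
      T ^ (n + 2) * D + (n + 2) • (T ^ (n + 1) * U) + (n + 2).choose 2 • (T ^ n * W) := by
  induction n with
  | zero =>
    have h : D * T ^ 2 = T * (D * T) + U * T := by
      rw [pow_two, ← mul_assoc, hDT, add_mul, mul_assoc, hDT]
    rw [zero_add, h, hDT, hUT]
    simp only [Nat.choose_self, pow_zero]
    noncomm_ring
  | succ n ih =>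
    have h1 : T ^ (n + 2) * D * T = T ^ (n + 3) * D + T ^ (n + 2) * U := by
      rw [mul_assoc, hDT, mul_add, ← mul_assoc, ← pow_succ]
    have h2 : T ^ (n + 1) * U * T = T ^ (n + 2) * U + T ^ (n + 1) * W := by
      rw [mul_assoc, hUT, mul_add, ← mul_assoc, ← pow_succ]
    have h3 : T ^ n * W * T = T ^ (n + 1) * W := by
      rw [mul_assoc, hWT, ← mul_assoc, ← pow_succ]
    rw [show n + 1 + 2 = n + 2 + 1 from rfl, pow_succ T (n + 2), ← mul_assoc D, ih, add_mul,
      add_mul, smul_mul_assoc, smul_mul_assoc, h1, h2, h3,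
      show (n + 2 + 1).choose 2 = (n + 2) + (n + 2).choose 2 by
        rw [Nat.choose_succ_succ (n + 2) 1, Nat.choose_one_right], ← pow_succ]
    simp only [smul_add, add_smul, one_smul]
    abel

/-- The commutation rule `D e^T = e^T (D + [D, T] + ½ [[D, T], T])` for nilpotent `T` with
`[[D, T], T]` commuting with `T`. The coefficients `c n` stand for `1 / n!`. -/
theorem mul_exp_of_commutators {S : Type*} [CommRing S] [Algebra S R] (c : ℕ → S)
    (hc : ∀ n, (n + 1 : ℕ) * c (n + 1) = c n) {half : S} (hhalf : 2 * half = 1)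
    (hDT : D * T = T * D + U) (hUT : U * T = T * U + W) (hWT : W * T = T * W) {M : ℕ}
    (hT : T ^ M = 0) :
    D * ∑ n ∈ Finset.range (M + 2), c n • T ^ n =
      (∑ n ∈ Finset.range (M + 2), c n • T ^ n) * (D + U + half • W) := by
  have hT1 : T ^ (M + 1) = 0 := by rw [pow_succ, hT, zero_mul]
  -- The exponential may be truncated at `M`, `M + 1` or `M + 2`. These lengths are matched to the
  -- terms with `W`, `U` and `D`, whose indices in `key` are shifted by two, one and zero.
  have e1 : ∑ n ∈ Finset.range (M + 2), c n • T ^ n = ∑ n ∈ Finset.range (M + 1), c n • T ^ n := by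
    rw [Finset.sum_range_succ, hT1, smul_zero, add_zero]
  have e0 : ∑ n ∈ Finset.range (M + 1), c n • T ^ n = ∑ n ∈ Finset.range M, c n • T ^ n := by
    rw [Finset.sum_range_succ, hT, smul_zero, add_zero]
  have key : ∀ n, D * (c (n + 2) • T ^ (n + 2)) =
      (c (n + 2) • T ^ (n + 2)) * D + (c (n + 1) • T ^ (n + 1)) * U
        + (c n • T ^ n) * (half • W) := fun n => by
    -- This is `binom(n+2, 2) / (n+2)! = ½ · 1/n!`.
    have h2 : (n + 2).choose 2 * c (n + 2) = half * c n := by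
      have h3 : (((n + 2).choose 2 : ℕ) : S) * 2 = ((n + 2 : ℕ) : S) * ((n + 1 : ℕ) : S) := by
        have : (n + 2).choose 2 * 2 = (n + 2) * (n + 1) := by
          simpa using (Nat.add_one_mul_choose_eq (n + 1) 1).symm
        rw [← Nat.cast_mul, ← this, Nat.cast_mul, Nat.cast_ofNat]
      rw [← hc n, ← hc (n + 1)]
      linear_combination (half * c (n + 2)) * h3 - (((n + 2).choose 2 : ℕ) : S) * c (n + 2) * hhalf
    rw [mul_smul_comm, mul_pow_of_commutators hDT hUT hWT, smul_add, smul_add,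
      ← Nat.cast_smul_eq_nsmul S, ← Nat.cast_smul_eq_nsmul S, smul_smul, smul_smul,
      mul_comm (c (n + 2)) ((n + 2 : ℕ) : S), show ((n + 2 : ℕ) : S) * c (n + 2) = c (n + 1) from
      hc (n + 1), mul_comm (c (n + 2)), h2, smul_mul_assoc, smul_mul_assoc, smul_mul_assoc,
      mul_smul_comm, smul_smul, mul_comm half]
  have s2 : ∀ f : ℕ → R, ∑ n ∈ Finset.range (M + 2), f n =
      (∑ n ∈ Finset.range M, f (n + 2)) + f 1 + f 0 := fun f => by
    rw [Finset.sum_range_succ', Finset.sum_range_succ']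
  have s1 : ∀ f : ℕ → R, ∑ n ∈ Finset.range (M + 1), f n =
      (∑ n ∈ Finset.range M, f (n + 1)) + f 0 := fun f => Finset.sum_range_succ' _ _
  have h0 : c 1 = c 0 := by simpa using hc 0
  have hU : (∑ n ∈ Finset.range (M + 2), c n • T ^ n) * U =
      (∑ n ∈ Finset.range M, (c (n + 1) • T ^ (n + 1)) * U) + c 0 • U := by
    rw [e1, s1, add_mul, Finset.sum_mul]; simp
  have hW : (∑ n ∈ Finset.range (M + 2), c n • T ^ n) * (half • W) =
      ∑ n ∈ Finset.range M, (c n • T ^ n) * (half • W) := by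
    rw [e1, e0, Finset.sum_mul]
  have hD : (∑ n ∈ Finset.range (M + 2), c n • T ^ n) * D =
      (∑ n ∈ Finset.range M, (c (n + 2) • T ^ (n + 2)) * D) + c 0 • (T * D) + c 0 • D := by
    rw [s2, add_mul, add_mul, Finset.sum_mul]; simp [h0]
  rw [mul_add, mul_add, hU, hW, hD, s2, mul_add, mul_add, Finset.mul_sum]
  simp only [key, Finset.sum_add_distrib, pow_one, pow_zero, mul_smul_comm, mul_one, h0, hDT,
    smul_add]
  abel

/-- If `s = (D + [D, T] + ½ [[D, T], T]) u` is annihilated by the nilpotent operator `T`, then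
`D (e^T u) = s`. -/
theorem exists_apply_eq_of_commutators {S V : Type*} [CommRing S] [AddCommGroup V] [Module S V]
    {D T U W : Module.End S V} {c : ℕ → S} (hc0 : c 0 = 1)
    (hc : ∀ n, (n + 1 : ℕ) * c (n + 1) = c n) {half : S} (hhalf : 2 * half = 1)
    (hDT : ∀ x, D (T x) = T (D x) + U x) (hUT : ∀ x, U (T x) = T (U x) + W x)
    (hWT : ∀ x, W (T x) = T (W x)) (hT : IsNilpotent T) {N : Submodule S V}
    (hTN : ∀ x ∈ N, T x ∈ N) {u s : V} (hu : u ∈ N) (hs : D u + U u + half • W u = s)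
    (hTs : T s = 0) : ∃ e ∈ N, D e = s := by
  obtain ⟨M, hM⟩ := hT
  have h := mul_exp_of_commutators (D := D) (T := T) (U := U) (W := W) c hc hhalf
    (LinearMap.ext hDT) (LinearMap.ext hUT) (LinearMap.ext hWT) hM
  have h1 := LinearMap.congr_fun h u
  refine ⟨_, ?_, h1.trans ?_⟩
  · rw [LinearMap.sum_apply]
    refine Submodule.sum_mem _ fun n _ => ?_
    rw [LinearMap.smul_apply]
    refine Submodule.smul_mem _ _ ?_
    clear * - hu hTN
    induction n with
    | zero => exact hu
    | succ n ih =>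
      rw [pow_succ']
      exact hTN _ ih
  · have h2 : (D + U + half • W) u = s := hs
    rw [Module.End.mul_apply, h2, LinearMap.sum_apply, Finset.sum_range_succ',
      Finset.sum_eq_zero, zero_add, hc0, one_smul, pow_zero, Module.End.one_apply]
    intro n _
    rw [LinearMap.smul_apply, pow_succ, Module.End.mul_apply, hTs, map_zero, smul_zero]

end Exponential

/-! ### Small extensions of Artinian algebras -/

/-- A nonzero ideal contains a nonzero element killed by a given nilpotent ideal. -/
lemma exists_mem_mul_eq_zero {R : Type*} [CommRing R] {m I : Ideal R} (hm : IsNilpotent m)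
    (hI : I ≠ ⊥) : ∃ ε ∈ I, ε ≠ 0 ∧ ∀ a ∈ m, a * ε = 0 := by
  obtain ⟨n, hn⟩ := hm
  have hn' : m ^ n * I = ⊥ := by rw [hn, Ideal.zero_eq_bot, Ideal.bot_mul]
  clear hn
  induction n with
  | zero => exact absurd (by simpa using hn') hI
  | succ n ih =>
    -- Any nonzero element of the last nonzero product `m ^ n * I` works.
    by_cases h : m ^ n * I = ⊥
    · exact ih h
    · obtain ⟨ε, hε, hε0⟩ := Submodule.exists_mem_ne_zero_of_ne_bot h
      have hle : m ^ n * I ≤ I := Ideal.mul_le_right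
      refine ⟨ε, hle hε, hε0, fun a ha => ?_⟩
      have h1 := Ideal.mul_mem_mul ha hε
      rwa [← mul_assoc, ← pow_succ', hn', Ideal.mem_bot] at h1

namespace ArtAlg

variable {k : Type w} {Λ : Type u} [Field k] [CommRing Λ] [Algebra k Λ]

lemma isNilpotent_maximalIdeal (A : ArtAlg k Λ) : IsNilpotent (maximalIdeal A.carrier) := by
  rw [← IsLocalRing.jacobson_eq_maximalIdeal (⊥ : Ideal A.carrier) bot_ne_top]
  exact IsArtinianRing.isNilpotent_jacobson_bot

/-- The quotient of `A` by the ideal generated by an element of the maximal ideal. -/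
def quot (A : ArtAlg k Λ) (ε : A.carrier) (hε : ε ∈ maximalIdeal A.carrier) : ArtAlg k Λ :=
  have hle : Ideal.span {ε} ≤ maximalIdeal A.carrier := by
    rwa [Ideal.span_le, Set.singleton_subset_iff]
  have : Nontrivial (A.carrier ⧸ Ideal.span {ε}) :=
    Ideal.Quotient.nontrivial_iff.mpr (ne_top_of_le_ne_top (Ideal.IsPrime.ne_top inferInstance) hle)
  have : IsLocalRing (A.carrier ⧸ Ideal.span {ε}) :=
    IsLocalRing.of_surjective' (Ideal.Quotient.mk _) Ideal.Quotient.mk_surjective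
  { carrier := A.carrier ⧸ Ideal.span {ε}
    residue_bijective := by
      refine ⟨RingHom.injective _, fun x => ?_⟩
      obtain ⟨x, rfl⟩ := residue_surjective x
      obtain ⟨a, rfl⟩ := Ideal.Quotient.mk_surjective x
      obtain ⟨c, hc⟩ := A.residue_bijective.2 (residue _ a)
      refine ⟨c, ?_⟩
      have h1 : algebraMap Λ A.carrier (algebraMap k Λ c) - a ∈ maximalIdeal A.carrier := by
        rw [← residue_eq_zero_iff, map_sub, ← hc, sub_eq_zero]; rfl
      have h2 := BaseChange.algHom_mem_maximalIdeal
        (Ideal.Quotient.mkₐ Λ (Ideal.span {ε})) h1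
      rw [← residue_eq_zero_iff, map_sub, map_sub, sub_eq_zero] at h2
      exact h2 }

/-- The projection `A → A / (ε)`. -/
def toQuot (A : ArtAlg k Λ) (ε : A.carrier) (hε : ε ∈ maximalIdeal A.carrier) :
    A.carrier →ₐ[Λ] (A.quot ε hε).carrier :=
  Ideal.Quotient.mkₐ Λ (Ideal.span {ε})

lemma toQuot_surjective (A : ArtAlg k Λ) (ε : A.carrier) (hε : ε ∈ maximalIdeal A.carrier) :
    Function.Surjective (A.toQuot ε hε) :=
  Ideal.Quotient.mkₐ_surjective _ _

lemma toQuot_eq_zero_iff (A : ArtAlg k Λ) {ε : A.carrier} (hε : ε ∈ maximalIdeal A.carrier)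
    {a : A.carrier} : A.toQuot ε hε a = 0 ↔ ∃ b, a = b * ε := by
  refine Ideal.Quotient.eq_zero_iff_mem.trans (Ideal.mem_span_singleton'.trans ?_)
  exact exists_congr fun b => eq_comm

lemma exists_comp_toQuot {A B : ArtAlg k Λ} {ε : A.carrier} (hε : ε ∈ maximalIdeal A.carrier)
    (π : A.carrier →ₐ[Λ] B.carrier) (h : π ε = 0) :
    ∃ π' : (A.quot ε hε).carrier →ₐ[Λ] B.carrier, π'.comp (A.toQuot ε hε) = π := by
  refine ⟨Ideal.Quotient.liftₐ (Ideal.span {ε}) π fun a ha => ?_, rfl⟩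
  obtain ⟨b, rfl⟩ := Ideal.mem_span_singleton'.mp ha
  rw [map_mul, h, mul_zero]

/-- Nonzero elements of the maximal ideal that are killed by the maximal ideal. -/
structure IsSmall (A : ArtAlg k Λ) (ε : A.carrier) : Prop where
  mem : ε ∈ maximalIdeal A.carrier
  ne_zero : ε ≠ 0
  mul_eq_zero : ∀ a ∈ maximalIdeal A.carrier, a * ε = 0

/-- A nonzero ideal contained in the maximal ideal contains an element killed by the maximal
ideal. -/
lemma exists_isSmall (A : ArtAlg k Λ) {I : Ideal A.carrier} (hI : I ≤ maximalIdeal A.carrier)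
    (h0 : I ≠ ⊥) : ∃ ε ∈ I, A.IsSmall ε := by
  obtain ⟨ε, hεI, hε0, hε⟩ := exists_mem_mul_eq_zero A.isNilpotent_maximalIdeal h0
  exact ⟨ε, hεI, ⟨hI hεI, hε0, hε⟩⟩

/-- Induction over small extensions. -/
theorem smallInduction {P : ArtAlg k Λ → Prop}
    (h : ∀ A : ArtAlg k Λ, (∀ ε (hε : A.IsSmall ε), P (A.quot ε hε.mem)) → P A)
    (A : ArtAlg k Λ) : P A := by
  -- All quotients of `A` are treated at once, through their kernels; the induction goes down from
  -- large ideals of the Noetherian ring `A`. There is no separate base case: if `𝔪` is zero there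
  -- are no small elements, and `h` must give `P` outright.
  suffices hI : ∀ (I : Ideal A.carrier) (C : ArtAlg k Λ) (π : A.carrier →ₐ[Λ] C.carrier),
      Function.Surjective π → RingHom.ker π = I → P C from
    hI _ A (AlgHom.id Λ _) Function.surjective_id rfl
  intro I
  induction I using WellFoundedGT.induction with
  | ind I ih =>
    rintro C π hπ rfl
    refine h C fun ε hε => ih _ ?_ _ ((C.toQuot ε hε.mem).comp π)
      ((C.toQuot_surjective ε hε.mem).comp hπ) rfl
    obtain ⟨e, rfl⟩ := hπ ε
    refine lt_of_le_of_ne (fun x hx => ?_) fun heq => hε.ne_zero ?_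
    · rw [RingHom.mem_ker] at hx ⊢
      change C.toQuot _ _ (π x) = 0
      rw [show π x = 0 from hx, map_zero]
    · have : e ∈ RingHom.ker π := by
        rw [heq]
        exact (C.toQuot_eq_zero_iff hε.mem).mpr ⟨1, (one_mul _).symm⟩
      exact this

lemma exists_algebraMap_sub_mem (A : ArtAlg k Λ) (a : A.carrier) :
    ∃ r : Λ, a - algebraMap Λ A.carrier r ∈ maximalIdeal A.carrier := by
  obtain ⟨r, hr⟩ := A.surjective_algebraMap_residueField (residue _ a)
  refine ⟨r, ?_⟩
  rw [← residue_eq_zero_iff, map_sub, ← hr, sub_eq_zero]; rfl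

variable [IsLocalRing Λ]

lemma algebraMap_mem_maximalIdeal (A : ArtAlg k Λ) {r : Λ} (hr : r ∈ maximalIdeal Λ) :
    algebraMap Λ A.carrier r ∈ maximalIdeal A.carrier := by
  have h := RingHom.ker_isMaximal_of_surjective _ A.surjective_algebraMap_residueField
  rw [← residue_eq_zero_iff]
  rw [← eq_maximalIdeal h] at hr
  exact hr

lemma toResidue_eq_zero (A : ArtAlg k Λ) {a : A.carrier} (ha : a ∈ maximalIdeal A.carrier) :
    A.toResidue a = 0 := by
  have := BaseChange.algHom_mem_maximalIdeal A.toResidue ha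
  rwa [maximalIdeal_eq_bot, Ideal.mem_bot] at this

lemma toResidue_surjective (A : ArtAlg k Λ) : Function.Surjective A.toResidue := fun x => by
  obtain ⟨r, rfl⟩ := residue_surjective x
  exact ⟨algebraMap Λ A.carrier r, A.toResidue.commutes r⟩

lemma toResidue_injective (A : ArtAlg k Λ) (h : maximalIdeal A.carrier = ⊥) :
    Function.Injective A.toResidue := by
  rw [injective_iff_map_eq_zero]
  intro a ha
  have : a ∈ maximalIdeal A.carrier := fun hu => (hu.map A.toResidue).ne_zero ha
  rwa [h, Ideal.mem_bot] at this

/-- Multiplication by a small element `ε`, as a map `Λ/𝔪_Λ → A`. -/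
def smallMul (A : ArtAlg k Λ) {ε : A.carrier} (hε : A.IsSmall ε) :
    ResidueField Λ →ₗ[Λ] A.carrier :=
  Submodule.liftQ (maximalIdeal Λ) (LinearMap.toSpanSingleton Λ A.carrier ε) fun r hr => by
    rw [LinearMap.mem_ker, LinearMap.toSpanSingleton_apply, Algebra.smul_def]
    exact hε.mul_eq_zero _ (A.algebraMap_mem_maximalIdeal hr)

lemma smallMul_residue (A : ArtAlg k Λ) {ε : A.carrier} (hε : A.IsSmall ε) (r : Λ) :
    A.smallMul hε (residue Λ r) = r • ε := rfl

lemma smallMul_injective (A : ArtAlg k Λ) {ε : A.carrier} (hε : A.IsSmall ε) :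
    Function.Injective (A.smallMul hε) := by
  rw [injective_iff_map_eq_zero]
  intro a ha
  obtain ⟨r, rfl⟩ := residue_surjective a
  rw [smallMul_residue] at ha
  by_contra h
  have hu : IsUnit r := by
    by_contra hu
    exact h ((residue_eq_zero_iff r).mpr hu)
  exact hε.ne_zero (hu.smul_eq_zero.mp ha)

/-- Only the residue of `a` acts on `ε`, since `A = Λ + 𝔪_A` and `𝔪_A ε = 0`. This identifies the
ideal `(ε)` with `Λ/𝔪_Λ`. -/
lemma smallMul_toResidue (A : ArtAlg k Λ) {ε : A.carrier} (hε : A.IsSmall ε) (a : A.carrier) :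
    A.smallMul hε (A.toResidue a) = ε * a := by
  obtain ⟨r, hr⟩ := A.exists_algebraMap_sub_mem a
  have h1 : A.toResidue a = residue Λ r := by
    have := A.toResidue_eq_zero hr
    rw [map_sub, sub_eq_zero, AlgHom.commutes] at this
    exact this
  have h2 := hε.mul_eq_zero _ hr
  rw [sub_mul, sub_eq_zero] at h2
  rw [h1, smallMul_residue, Algebra.smul_def, mul_comm ε, h2]

end ArtAlg

/-! ### Base change along small extensions -/

namespace BaseChange

section

variable {Λ : Type u} [CommRing Λ] {M : Type v} [AddCommGroup M] [Module Λ M]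

@[elab_as_elim]
lemma induction_mem {A : Type*} [CommRing A] [Algebra Λ A] {N : Submodule Λ M}
    {P : ∀ x : A ⊗[Λ] M, x ∈ N.baseChange A → Prop} (zero : P 0 (zero_mem _))
    (tmul : ∀ (c : A) (n : M) (hn : n ∈ N),
      P (c ⊗ₜ n) (Submodule.tmul_mem_baseChange_of_mem c hn))
    (add : ∀ x y hx hy, P x hx → P y hy → P (x + y) (add_mem hx hy))
    {x : A ⊗[Λ] M} (hx : x ∈ N.baseChange A) : P x hx := by
  obtain ⟨z, rfl⟩ := hx
  induction z using TensorProduct.induction_on with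
  | zero => simpa using zero
  | tmul c n => exact tmul c n.1 n.2
  | add x y hx hy => simpa using add _ _ ⟨x, rfl⟩ ⟨y, rfl⟩ hx hy

lemma map_map {A B C : Type*} [CommRing A] [Algebra Λ A] [CommRing B] [Algebra Λ B] [CommRing C]
    [Algebra Λ C] (f : A →ₐ[Λ] B) (g : B →ₐ[Λ] C) (x : A ⊗[Λ] M) :
    map M g (map M f x) = map M (g.comp f) x := by
  induction x using TensorProduct.induction_on with
  | zero => simp
  | tmul b m => rfl
  | add x y hx hy => simp only [_root_.map_add, hx, hy]

lemma exists_lift_mem {A B : Type*} [CommRing A] [Algebra Λ A] [CommRing B] [Algebra Λ B]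
    {π : A →ₐ[Λ] B} (hπ : Function.Surjective π) {N : Submodule Λ M} {x : B ⊗[Λ] M}
    (hx : x ∈ N.baseChange B) : ∃ z ∈ N.baseChange A, map M π z = x := by
  induction hx using induction_mem with
  | zero => exact ⟨0, zero_mem _, _root_.map_zero _⟩
  | tmul c n hn =>
    obtain ⟨b, rfl⟩ := hπ c
    exact ⟨b ⊗ₜ n, Submodule.tmul_mem_baseChange_of_mem b hn, rfl⟩
  | add x y _ _ hx hy =>
    obtain ⟨z, hz, rfl⟩ := hx
    obtain ⟨t, ht, rfl⟩ := hy
    exact ⟨z + t, add_mem hz ht, _root_.map_add _ _ _⟩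

lemma exists_lift_mem_maximalIdeal_smul {A B : Type*} [CommRing A] [Algebra Λ A] [CommRing B]
    [Algebra Λ B] [IsLocalRing A] [IsLocalRing B] {π : A →ₐ[Λ] B} (hπ : Function.Surjective π)
    {N : Submodule Λ M} {x : B ⊗[Λ] M} (hx : x ∈ maximalIdeal B • N.baseChange B) :
    ∃ z ∈ maximalIdeal A • N.baseChange A, map M π z = x := by
  induction hx using Submodule.smul_induction_on' with
  | smul b hb y hy =>
    obtain ⟨a, rfl⟩ := hπ b
    obtain ⟨z, hz, rfl⟩ := exists_lift_mem hπ hy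
    have ha : a ∈ maximalIdeal A := fun hu => hb (hu.map π)
    exact ⟨a • z, Submodule.smul_mem_smul ha hz, map_smul _ _ _⟩
  | add x _ y _ hx hy =>
    obtain ⟨z, hz, rfl⟩ := hx
    obtain ⟨t, ht, rfl⟩ := hy
    exact ⟨z + t, add_mem hz ht, _root_.map_add _ _ _⟩

/-- Only linearity of `g` is assumed, so that it applies to `smallMul`, which is not a ring
homomorphism. -/
lemma rTensor_baseChange {A B : Type*} [CommRing A] [Algebra Λ A] [CommRing B] [Algebra Λ B]
    (g : A →ₗ[Λ] B) (f : M →ₗ[Λ] M) (x : A ⊗[Λ] M) :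
    g.rTensor M (f.baseChange A x) = f.baseChange B (g.rTensor M x) := by
  induction x using TensorProduct.induction_on with
  | zero => simp
  | tmul b m => simp
  | add x y hx hy => simp only [_root_.map_add, hx, hy]

lemma baseChange_eq_self {A : Type*} [CommRing A] [Algebra Λ A] {N : Submodule Λ M}
    {p : M →ₗ[Λ] M} (hpN : ∀ x ∈ N, p x = x) {x : A ⊗[Λ] M} (hx : x ∈ N.baseChange A) :
    p.baseChange A x = x := by
  induction hx using induction_mem with
  | zero => exact _root_.map_zero _
  | tmul c n hn => rw [LinearMap.baseChange_tmul, hpN n hn]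
  | add y z _ _ hy hz => rw [_root_.map_add, hy, hz]

lemma baseChange_eq_zero {A : Type*} [CommRing A] [Algebra Λ A] {N : Submodule Λ M}
    {p : M →ₗ[Λ] M} (hpN : ∀ x ∈ N, p x = 0) {x : A ⊗[Λ] M} (hx : x ∈ N.baseChange A) :
    p.baseChange A x = 0 := by
  induction hx using induction_mem with
  | zero => exact _root_.map_zero _
  | tmul c n hn => rw [LinearMap.baseChange_tmul, hpN n hn, TensorProduct.tmul_zero]
  | add y z _ _ hy hz => rw [_root_.map_add, hy, hz, add_zero]

lemma bilin_mem {A : Type*} [CommRing A] [Algebra Λ A] (F : M →ₗ[Λ] M →ₗ[Λ] M)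
    {S T N : Submodule Λ M} (h : ∀ x ∈ S, ∀ y ∈ T, F x y ∈ N) {x y : A ⊗[Λ] M}
    (hx : x ∈ S.baseChange A) (hy : y ∈ T.baseChange A) :
    LinearMap.BilinMap.baseChange A F x y ∈ N.baseChange A := by
  induction hx using induction_mem with
  | zero => simp
  | add x z _ _ hx hz => rw [_root_.map_add, LinearMap.add_apply]; exact add_mem hx hz
  | tmul c n hn =>
    induction hy using induction_mem with
    | zero => simp
    | add x z _ _ hx hz => rw [_root_.map_add]; exact add_mem hx hz
    | tmul b m hm =>
      rw [LinearMap.BilinMap.baseChange_tmul]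
      exact Submodule.tmul_mem_baseChange_of_mem _ (h n hn m hm)

lemma exists_add_of_mem_sup {A : Type*} [CommRing A] [Algebra Λ A] {N N' : Submodule Λ M}
    {x : A ⊗[Λ] M} (hx : x ∈ (N ⊔ N').baseChange A) :
    ∃ y ∈ N.baseChange A, ∃ z ∈ N'.baseChange A, y + z = x := by
  rw [← Submodule.mem_sup]
  induction hx using induction_mem with
  | zero => exact zero_mem _
  | add x y _ _ hx hy => exact add_mem hx hy
  | tmul c n hn =>
    obtain ⟨y, hy, z, hz, rfl⟩ := Submodule.mem_sup.mp hn
    rw [TensorProduct.tmul_add]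
    exact Submodule.add_mem_sup (Submodule.tmul_mem_baseChange_of_mem c hy)
      (Submodule.tmul_mem_baseChange_of_mem c hz)

lemma mem_baseChange_of_mem_smul {A : Type*} [CommRing A] [Algebra Λ A] {I : Ideal Λ}
    {N : Submodule Λ M} {m : M} (hm : m ∈ I • N) : (1 : A) ⊗ₜ[Λ] m ∈ N.baseChange A :=
  Submodule.tmul_mem_baseChange_of_mem _ (Submodule.smul_le_right hm)

/-- Membership in the base change of a direct summand can be tested after applying an injective
map that commutes with base changes of endomorphisms. -/
lemma mem_of_projection {A B : Type*} [CommRing A] [Algebra Λ A] [CommRing B] [Algebra Λ B]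
    {N : Submodule Λ M} {p : M →ₗ[Λ] M} (hp : ∀ x, p x ∈ N) (hpN : ∀ x ∈ N, p x = x)
    {g : A →ₗ[Λ] B} (hg : Function.Injective (g.rTensor M)) {x : A ⊗[Λ] M}
    (hx : g.rTensor M x ∈ N.baseChange B) : x ∈ N.baseChange A := by
  have h1 : p.baseChange B (g.rTensor M x) = g.rTensor M x := baseChange_eq_self hpN hx
  have h2 := rTensor_baseChange g p x
  have h3 : p.baseChange A x = x := hg (h2.trans h1)
  rw [← h3]
  refine baseChange_mem (S := ⊤) p (fun x _ => hp x) ?_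
  rw [Submodule.baseChange_top]
  trivial

lemma small_smul_eq_zero {k : Type w} [Field k] [Algebra k Λ] (A : ArtAlg k Λ) {ε : A.carrier}
    (hε : A.IsSmall ε) {N : Submodule A.carrier (A.carrier ⊗[Λ] M)} {x : A.carrier ⊗[Λ] M}
    (hx : x ∈ maximalIdeal A.carrier • N) : ε • x = 0 := by
  induction hx using Submodule.smul_induction_on' with
  | smul b hb y hy => rw [smul_smul, mul_comm, hε.mul_eq_zero b hb, zero_smul]
  | add x _ y _ hx hy => rw [smul_add, hx, hy, add_zero]

end

variable {k : Type w} {Λ : Type u} [Field k] [CommRing Λ] [Algebra k Λ] [IsLocalRing Λ]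
  {M : Type v} [AddCommGroup M] [Module Λ M] (A : ArtAlg k Λ) {ε : A.carrier} (hε : A.IsSmall ε)


lemma one_tmul_mem_smul (A : ArtAlg k Λ) {N : Submodule Λ M} {m : M}
    (hm : m ∈ maximalIdeal Λ • N) :
    (1 : A.carrier) ⊗ₜ[Λ] m ∈ maximalIdeal A.carrier • N.baseChange A.carrier := by
  induction hm using Submodule.smul_induction_on' with
  | smul r hr n hn =>
    rw [TensorProduct.tmul_smul, ← algebraMap_smul A.carrier r]
    exact Submodule.smul_mem_smul (A.algebraMap_mem_maximalIdeal hr)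
      (Submodule.tmul_mem_baseChange_of_mem _ hn)
  | add x _ y _ hx hy => rw [TensorProduct.tmul_add]; exact add_mem hx hy

/-- Multiplication by a small element `ε`, as a map from the base change to the residue field. -/
def smallMap : ResidueField Λ ⊗[Λ] M →ₗ[Λ] A.carrier ⊗[Λ] M := (A.smallMul hε).rTensor M

lemma smallMap_injective [Module.Flat Λ M] : Function.Injective (smallMap A hε (M := M)) :=
  Module.Flat.rTensor_preserves_injective_linearMap _ (A.smallMul_injective hε)

lemma smallMap_baseChange (f : M →ₗ[Λ] M) (x : ResidueField Λ ⊗[Λ] M) :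
    smallMap A hε (f.baseChange _ x) = f.baseChange _ (smallMap A hε x) :=
  rTensor_baseChange _ f x

lemma smallMap_map_toResidue (x : A.carrier ⊗[Λ] M) :
    smallMap A hε (map M A.toResidue x) = ε • x := by
  induction x using TensorProduct.induction_on with
  | zero => simp
  | tmul b m => simp [smallMap, map, A.smallMul_toResidue, TensorProduct.smul_tmul']
  | add x y hx hy => simp only [_root_.map_add, hx, hy, smul_add]

lemma exists_smallMap_eq_smul {N : Submodule Λ M} {x : ResidueField Λ ⊗[Λ] M}
    (hx : x ∈ N.baseChange (ResidueField Λ)) :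
    ∃ z ∈ N.baseChange A.carrier, smallMap A hε x = ε • z := by
  obtain ⟨z, hz, rfl⟩ := exists_lift_mem A.toResidue_surjective hx
  exact ⟨z, hz, smallMap_map_toResidue A hε z⟩

/-- The second argument is a multiple of `ε`; by bilinearity `ε` moves onto `a`, which it kills.
Hence corrections by multiples of `ε` enter the Maurer-Cartan equations only linearly. -/
lemma bilin_smallMap_right (F : M →ₗ[Λ] M →ₗ[Λ] M)
    {N : Submodule A.carrier (A.carrier ⊗[Λ] M)} {a : A.carrier ⊗[Λ] M}
    (ha : a ∈ maximalIdeal A.carrier • N) (x : ResidueField Λ ⊗[Λ] M) :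
    LinearMap.BilinMap.baseChange A.carrier F a (smallMap A hε x) = 0 := by
  obtain ⟨z, -, hz⟩ := exists_smallMap_eq_smul A hε (N := ⊤) (x := x)
    (by rw [Submodule.baseChange_top]; trivial)
  rw [hz, _root_.map_smul, ← LinearMap.smul_apply, ← _root_.map_smul,
    small_smul_eq_zero A hε ha, _root_.map_zero, LinearMap.zero_apply]

lemma bilin_smallMap_left (F : M →ₗ[Λ] M →ₗ[Λ] M)
    {N : Submodule A.carrier (A.carrier ⊗[Λ] M)} {a : A.carrier ⊗[Λ] M}
    (ha : a ∈ maximalIdeal A.carrier • N) (x : ResidueField Λ ⊗[Λ] M) :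
    LinearMap.BilinMap.baseChange A.carrier F (smallMap A hε x) a = 0 := by
  obtain ⟨z, -, hz⟩ := exists_smallMap_eq_smul A hε (N := ⊤) (x := x)
    (by rw [Submodule.baseChange_top]; trivial)
  rw [hz, _root_.map_smul, LinearMap.smul_apply, ← _root_.map_smul,
    small_smul_eq_zero A hε ha, _root_.map_zero]

lemma smallMap_mem {N : Submodule Λ M} {x : ResidueField Λ ⊗[Λ] M}
    (hx : x ∈ N.baseChange (ResidueField Λ)) :
    smallMap A hε x ∈ maximalIdeal A.carrier • N.baseChange A.carrier := by
  obtain ⟨z, hz, h⟩ := exists_smallMap_eq_smul A hε hx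
  rw [h]
  exact Submodule.smul_mem_smul hε.mem hz

/-- The kernel of the projection `A ⊗ M → A / (ε) ⊗ M`. -/
lemma exists_smallMap_eq [Module.Flat Λ M] {x : A.carrier ⊗[Λ] M}
    (hx : map M (A.toQuot ε hε.mem) x = 0) : ∃ z, smallMap A hε z = x := by
  have hex : Function.Exact (A.smallMul hε) (A.toQuot ε hε.mem).toLinearMap := fun a => by
    change A.toQuot ε hε.mem a = 0 ↔ _
    rw [A.toQuot_eq_zero_iff hε.mem]
    constructor
    · rintro ⟨b, rfl⟩
      exact ⟨A.toResidue b, by rw [A.smallMul_toResidue, mul_comm]⟩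
    · rintro ⟨c, rfl⟩
      obtain ⟨b, rfl⟩ := A.toResidue_surjective c
      exact ⟨b, by rw [A.smallMul_toResidue, mul_comm]⟩
  exact (Module.Flat.rTensor_exact M hex x).mp hx

lemma map_toQuot_smallMap (x : ResidueField Λ ⊗[Λ] M) :
    map M (A.toQuot ε hε.mem) (smallMap A hε x) = 0 := by
  obtain ⟨z, -, hz⟩ := exists_smallMap_eq_smul A hε (N := ⊤) (x := x)
    (by rw [Submodule.baseChange_top]; trivial)
  rw [hz, map_smul, (A.toQuot_eq_zero_iff hε.mem).mpr ⟨1, (one_mul ε).symm⟩, zero_smul]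

end BaseChange

namespace CurvedBVAlgebra

section

variable {Λ : Type u} [CommRing Λ] [IsLocalRing Λ] {d : ℕ} {G : Type v} [AddCommGroup G]
  [Module Λ G] (X : CurvedBVAlgebra Λ d G)

/-! ### The grading -/

lemma iSup_gr_eq_top : ⨆ i : ℤ × ℤ, X.gr i.1 i.2 = ⊤ := X.isInternal.submodule_iSup_eq_top

@[elab_as_elim]
lemma induction_gr {P : G → Prop} (zero : P 0) (mem : ∀ p q, ∀ x ∈ X.gr p q, P x)
    (add : ∀ x y, P x → P y → P (x + y)) (x : G) : P x := by
  have hx : x ∈ ⨆ i : ℤ × ℤ, X.gr i.1 i.2 := by rw [X.iSup_gr_eq_top]; trivial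
  exact Submodule.iSup_induction _ (motive := P) hx (fun i => mem i.1 i.2) zero add

include X in
lemma flat_carrier : Module.Flat Λ G := by
  have : ∀ i : ℤ × ℤ, Module.Flat Λ (X.gr i.1 i.2) := fun i => X.flat i.1 i.2
  exact Module.Flat.of_linearEquiv
    (LinearEquiv.ofBijective (DirectSum.coeLinearMap fun i : ℤ × ℤ => X.gr i.1 i.2)
      X.isInternal).symm

/-- The sum of the homogeneous parts with indices in a set `s` is a direct summand. -/
lemma exists_projection (s : Set (ℤ × ℤ)) : ∃ p : G →ₗ[Λ] G,
    (∀ x, p x ∈ ⨆ i ∈ s, X.gr i.1 i.2) ∧ (∀ x ∈ ⨆ i ∈ s, X.gr i.1 i.2, p x = x) ∧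
      ∀ x ∈ ⨆ i ∈ sᶜ, X.gr i.1 i.2, p x = 0 := by
  have hc : IsCompl (⨆ i ∈ s, X.gr i.1 i.2) (⨆ i ∈ sᶜ, X.gr i.1 i.2) :=
    ⟨X.isInternal.submodule_iSupIndep.disjoint_biSup_biSup disjoint_compl_right, by
      rw [codisjoint_iff, ← iSup_union, Set.union_compl_self, iSup_univ]
      exact X.iSup_gr_eq_top⟩
  refine ⟨Submodule.projection _ _ hc, fun x => ?_, fun x hx => ?_, fun x hx => ?_⟩
  · exact Submodule.projection_apply_mem hc x
  · exact Submodule.projection_apply_of_mem_left hc hx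
  · exact Submodule.projection_apply_of_mem_right hc hx

/-- Projections survive base change, so bidegree components can be compared in `A ⊗ G` without
constructing a grading there. -/
lemma exists_projection_gr (p q : ℤ) : ∃ f : G →ₗ[Λ] G, (∀ x, f x ∈ X.gr p q) ∧
    (∀ x ∈ X.gr p q, f x = x) ∧ ∀ p' q', (p', q') ≠ (p, q) → ∀ x ∈ X.gr p' q', f x = 0 := by
  obtain ⟨f, h1, h2, h3⟩ := X.exists_projection {(p, q)}
  simp only [Set.mem_singleton_iff, iSup_iSup_eq_left] at h1 h2
  refine ⟨f, h1, h2, fun p' q' h x hx => h3 x ?_⟩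
  exact Submodule.mem_iSup_of_mem (p', q') (Submodule.mem_iSup_of_mem h hx)

lemma tot_eq (n : ℤ) : X.tot n = ⨆ i ∈ {i : ℤ × ℤ | i.1 + i.2 = n}, X.gr i.1 i.2 := by
  refine le_antisymm (iSup_le fun p => ?_) (iSup₂_le fun i hi => ?_)
  · exact le_iSup₂_of_le
      (f := fun (i : ℤ × ℤ) (_ : i ∈ {i : ℤ × ℤ | i.1 + i.2 = n}) => X.gr i.1 i.2) (p, n - p) (by simp) le_rfl
  · have hi : i.1 + i.2 = n := hi
    exact le_iSup_of_le i.1 (by rw [show n - i.1 = i.2 by omega])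

lemma gr_le_tot {p q n : ℤ} (h : p + q = n) : X.gr p q ≤ X.tot n :=
  le_iSup_of_le (f := fun p => X.gr p (n - p)) p (by rw [show n - p = q by omega])

@[elab_as_elim]
lemma induction_tot {n : ℤ} {P : ∀ x : G, x ∈ X.tot n → Prop} (zero : P 0 (zero_mem _))
    (mem : ∀ p q, ∀ h : p + q = n, ∀ x, ∀ hx : x ∈ X.gr p q, P x (X.gr_le_tot h hx))
    (add : ∀ x y hx hy, P x hx → P y hy → P (x + y) (add_mem hx hy)) {x : G}
    (hx : x ∈ X.tot n) : P x hx :=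
  Submodule.iSup_induction' _ (motive := P) (fun p => mem p (n - p) (by ring)) zero add hx

/-! ### Calculus with elements of degree zero -/

lemma mul_mem_tot {n : ℤ} {a x : G} (ha : a ∈ X.tot 0) (hx : x ∈ X.tot n) :
    X.mul a x ∈ X.tot n := by
  induction ha using X.induction_tot with
  | zero => simp
  | add a b _ _ ha hb => rw [map_add, LinearMap.add_apply]; exact add_mem ha hb
  | mem p q h a ha =>
    induction hx using X.induction_tot with
    | zero => simp
    | add a b _ _ ha hb => rw [map_add]; exact add_mem ha hb
    | mem p' q' h' x hx => exact X.gr_le_tot (by omega) (X.mul_mem ha hx)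

lemma mul_comm_tot {a : G} (ha : a ∈ X.tot 0) (x : G) : X.mul a x = X.mul x a := by
  induction ha using X.induction_tot with
  | zero => simp
  | add a b _ _ ha hb => simp only [map_add, LinearMap.add_apply, ha, hb]
  | mem p q h a ha =>
    induction x using X.induction_gr with
    | zero => simp
    | add x y hx hy => simp only [map_add, LinearMap.add_apply, hx, hy]
    | mem p' q' x hx => rw [X.mul_comm ha hx, h, zero_mul, Int.negOnePow_zero, one_smul]

lemma one_mem_tot : X.one ∈ X.tot 0 := X.gr_le_tot (by ring) X.one_mem

lemma mul_one {x : G} : X.mul x X.one = x := by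
  rw [← X.mul_comm_tot X.one_mem_tot, X.one_mul]

lemma mul_left_comm {a : G} (ha : a ∈ X.tot 0) (x y : G) :
    X.mul x (X.mul a y) = X.mul a (X.mul x y) := by
  rw [← X.mul_assoc, ← X.mul_comm_tot ha, X.mul_assoc]

/-- The sign `(-1)^((|a|+1)|b|)` is trivial because `|b| = 0`. With `b = a` this yields the second
commutator, `[a, a] ∧`, in the exponential formula. -/
lemma bracket_mul_tot {a b : G} (ha : a ∈ X.tot 0) (hb : b ∈ X.tot 0) (x : G) :
    X.bracket a (X.mul b x) = X.mul (X.bracket a b) x + X.mul b (X.bracket a x) := by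
  induction ha using X.induction_tot with
  | zero => simp
  | add a b _ _ ha hb => simp only [map_add, LinearMap.add_apply, ha, hb]; abel
  | mem p q h a ha =>
  induction hb using X.induction_tot with
  | zero => simp
  | add a b _ _ ha hb => simp only [map_add, LinearMap.add_apply, ha, hb]; abel
  | mem p' q' h' b hb =>
  induction x using X.induction_gr with
  | zero => simp
  | add x y hx hy => simp only [map_add, hx, hy]; abel
  | mem p'' q'' x hx =>
    rw [X.bracket_mul ha hb hx, h', mul_zero, Int.negOnePow_zero, one_smul]

/-- A derivation kills the unit: apply the Leibniz rule to `1 ∧ 1`. -/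
lemma bracket_one {a : G} (ha : a ∈ X.tot 0) : X.bracket a X.one = 0 := by
  have h := X.bracket_mul_tot ha X.one_mem_tot X.one
  rwa [X.one_mul, X.one_mul, X.mul_one, left_eq_add] at h

/-- Both shifted degrees are `1`, so graded antisymmetry becomes symmetry. -/
lemma bracket_comm {a b : G} (ha : a ∈ X.tot 0) (hb : b ∈ X.tot 0) :
    X.bracket a b = X.bracket b a := by
  induction ha using X.induction_tot with
  | zero => simp
  | add a b _ _ ha hb => simp only [map_add, LinearMap.add_apply, ha, hb]
  | mem p q h a ha =>
  induction hb using X.induction_tot with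
  | zero => simp
  | add a b _ _ ha hb => simp only [map_add, LinearMap.add_apply, ha, hb]
  | mem p' q' h' b hb =>
    rw [X.bracket_antisymm ha hb, h, h']
    simp

lemma ell_mem_gr : X.ell ∈ X.gr (-1) 2 := Submodule.smul_le_right X.ell_mem

lemma y_mem_gr : X.y ∈ X.gr 0 1 := Submodule.smul_le_right X.y_mem

/-! ### Commutators of `ď` with products, and `ď² = 0`. -/

lemma dcheck_apply (x : G) :
    X.dcheck x = X.Del x + X.dbar x + X.mul (X.ell + X.y) x := rfl

/-- This is the Batalin-Vilkovisky identity, read as a formula for the commutator of `Δ` with `a ∧`.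
-/
lemma Del_mul_tot {a : G} (ha : a ∈ X.tot 0) (x : G) :
    X.Del (X.mul a x) = X.mul a (X.Del x) + X.bracket a x + X.mul (X.Del a) x := by
  induction ha using X.induction_tot with
  | zero => simp
  | add a b _ _ ha hb => simp only [map_add, LinearMap.add_apply, ha, hb]; abel
  | mem p q h a ha =>
  induction x using X.induction_gr with
  | zero => simp
  | add x y hx hy => simp only [map_add, hx, hy]; abel
  | mem p' q' x hx =>
    have := X.bracket_eq ha hx
    rw [h, Int.negOnePow_zero, one_smul, one_smul] at this
    rw [this]; abel

lemma dbar_mul_tot {a : G} (ha : a ∈ X.tot 0) (x : G) :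
    X.dbar (X.mul a x) = X.mul a (X.dbar x) + X.mul (X.dbar a) x := by
  induction ha using X.induction_tot with
  | zero => simp
  | add a b _ _ ha hb => simp only [map_add, LinearMap.add_apply, ha, hb]; abel
  | mem p q h a ha =>
  induction x using X.induction_gr with
  | zero => simp
  | add x y hx hy => simp only [map_add, hx, hy]; abel
  | mem p' q' x hx =>
    rw [X.dbar_mul ha hx, h, Int.negOnePow_zero, one_smul, add_comm]

/-- The commutators of `Δ` and of `∂̄` with `a ∧` add up; the summand `(ℓ + y) ∧` of `ď` contributes
nothing because `a` is even. -/
lemma dcheck_mul {a : G} (ha : a ∈ X.tot 0) (x : G) :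
    X.dcheck (X.mul a x) =
      X.mul a (X.dcheck x) + (X.bracket a x + X.mul ((X.Del + X.dbar) a) x) := by
  simp only [dcheck_apply, X.Del_mul_tot ha, X.dbar_mul_tot ha, X.mul_left_comm ha, map_add,
    LinearMap.add_apply]
  abel

lemma Del_eq_zero {q : ℤ} {x : G} (hx : x ∈ X.gr 0 q) : X.Del x = 0 := by
  have h := X.Del_mem hx
  rwa [X.gr_eq_bot _ _ (by omega), Submodule.mem_bot] at h

lemma dcheck_one : X.dcheck X.one = X.ell + X.y := by
  have h : X.dbar X.one = 0 := by
    have := X.dbar_mul X.one_mem X.one_mem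
    rwa [X.one_mul, X.mul_one, X.one_mul, zero_add, Int.negOnePow_zero, one_smul,
      left_eq_add] at this
  rw [dcheck_apply, X.Del_eq_zero X.one_mem, h, X.mul_one, zero_add, zero_add]

lemma bracket_zero_zero {q q' : ℤ} {a b : G} (ha : a ∈ X.gr 0 q) (hb : b ∈ X.gr 0 q') :
    X.bracket a b = 0 := by
  have h := X.bracket_mem ha hb
  rwa [X.gr_eq_bot _ _ (by omega), Submodule.mem_bot] at h

lemma dcheck_mem_tot {n : ℤ} {x : G} (hx : x ∈ X.tot (n - 1)) : X.dcheck x ∈ X.tot n := by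
  induction hx using X.induction_tot with
  | zero => simp
  | add x y _ _ hx hy => rw [map_add]; exact add_mem hx hy
  | mem p q h x hx =>
    rw [dcheck_apply, map_add, LinearMap.add_apply]
    exact add_mem (add_mem (X.gr_le_tot (by omega) (X.Del_mem hx))
      (X.gr_le_tot (by omega) (X.dbar_mem hx)))
      (add_mem (X.gr_le_tot (by omega) (X.mul_mem X.ell_mem_gr hx))
        (X.gr_le_tot (by omega) (X.mul_mem X.y_mem_gr hx)))

/-- The rules for the product with an element of odd total degree. -/
lemma Del_add_dbar_mul_odd {p q : ℤ} {a : G} (ha : a ∈ X.gr p q) (h : p + q = 1) (x : G) :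
    (X.Del + X.dbar) (X.mul a x) + X.mul a ((X.Del + X.dbar) x) =
      X.mul ((X.Del + X.dbar) a) x - X.bracket a x := by
  induction x using X.induction_gr with
  | zero => simp
  | add x y hx hy =>
    rw [map_add, map_add, map_add, map_add, map_add, map_add, add_add_add_comm, hx, hy]
    abel
  | mem p' q' x hx =>
    have h1 := X.bracket_eq ha hx
    have h2 := X.dbar_mul ha hx
    rw [h, Int.negOnePow_one, Units.neg_smul, one_smul] at h1 h2
    rw [Units.neg_smul, one_smul] at h1
    simp only [LinearMap.add_apply, map_add, h2]
    rw [← neg_neg (X.bracket a x), h1]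
    abel

lemma mul_self_odd {half : Λ} (hhalf : 2 * half = 1) {a : G}
    (h : X.mul a a = -X.mul a a) : X.mul a a = 0 := by
  have h1 : (2 : Λ) • X.mul a a = 0 := by
    rw [two_smul]; nth_rewrite 1 [h]; exact neg_add_cancel _
  rw [← one_smul Λ (X.mul a a), ← hhalf, _root_.mul_comm, mul_smul, h1, smul_zero]

/-- Expand `ď²`. The square of `Δ + ∂̄` is `[ℓ + y, -]`. Its anticommutator with `(ℓ + y) ∧` is `-[ℓ
+ y, -]`, because `(Δ + ∂̄)(ℓ + y) = 0`. The square of `(ℓ + y) ∧` vanishes because `ℓ + y` is odd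
and `2` is invertible. -/
lemma dcheck_dcheck {half : Λ} (hhalf : 2 * half = 1) (x : G) : X.dcheck (X.dcheck x) = 0 := by
  have h1 := X.Del_add_dbar_mul_odd X.ell_mem_gr (by norm_num) x
  have h2 := X.Del_add_dbar_mul_odd X.y_mem_gr (by norm_num) x
  have hanti : ∀ {p q p' q' : ℤ} {a b : G}, a ∈ X.gr p q → b ∈ X.gr p' q' → p + q = 1 →
      p' + q' = 1 → X.mul a b = -X.mul b a := fun ha hb h h' => by
    rw [X.mul_comm ha hb, h, h', _root_.mul_one, Int.negOnePow_one, Units.neg_smul, one_smul]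
  have h3 : X.mul (X.ell + X.y) (X.ell + X.y) = 0 := by
    refine X.mul_self_odd hhalf ?_
    have e1 := hanti X.ell_mem_gr X.ell_mem_gr (by norm_num) (by norm_num)
    have e2 := hanti X.y_mem_gr X.y_mem_gr (by norm_num) (by norm_num)
    have e3 := hanti X.ell_mem_gr X.y_mem_gr (by norm_num) (by norm_num)
    simp only [map_add, LinearMap.add_apply]
    nth_rewrite 1 [e1]
    nth_rewrite 1 [e2]
    rw [e3]
    abel
  have h4 : (X.Del + X.dbar) ((X.Del + X.dbar) x) = X.bracket (X.ell + X.y) x := by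
    rw [map_add X.bracket, LinearMap.add_apply (X.bracket _), ← X.Del_dbar, ← X.dbar_dbar]
    simp only [LinearMap.add_apply, map_add, X.Del_Del]
    abel
  have h5 : (X.Del + X.dbar) (X.ell + X.y) = 0 := by
    simp only [LinearMap.add_apply, map_add, X.dbar_ell, X.Del_eq_zero X.y_mem_gr, add_zero,
      X.Del_ell, zero_add]
  have h6 : X.mul (X.ell + X.y) (X.mul (X.ell + X.y) x) = 0 := by
    rw [← X.mul_assoc, h3, map_zero, LinearMap.zero_apply]
  have h7 : (X.Del + X.dbar) (X.mul (X.ell + X.y) x) + X.mul (X.ell + X.y) ((X.Del + X.dbar) x) =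
      - X.bracket (X.ell + X.y) x := by
    have h8 : X.mul ((X.Del + X.dbar) X.ell) x + X.mul ((X.Del + X.dbar) X.y) x = 0 := by
      rw [← LinearMap.add_apply, ← map_add, ← map_add, h5, map_zero, LinearMap.zero_apply]
    rw [map_add X.mul, LinearMap.add_apply (X.mul _), LinearMap.add_apply (X.mul _),
      map_add (X.Del + X.dbar),
      add_add_add_comm, h1, h2, map_add X.bracket, LinearMap.add_apply (X.bracket _),
        sub_add_sub_comm, h8,
      zero_sub]
  have h9 : X.dcheck (X.dcheck x) = (X.Del + X.dbar) ((X.Del + X.dbar) x) +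
      ((X.Del + X.dbar) (X.mul (X.ell + X.y) x) + X.mul (X.ell + X.y) ((X.Del + X.dbar) x)) +
      X.mul (X.ell + X.y) (X.mul (X.ell + X.y) x) := by
    change (X.Del + X.dbar) ((X.Del + X.dbar) x + X.mul (X.ell + X.y) x) +
      X.mul (X.ell + X.y) ((X.Del + X.dbar) x + X.mul (X.ell + X.y) x) = _
    rw [map_add (X.Del + X.dbar), map_add (X.mul _)]
    abel
  rw [h9, h4, h6, h7, add_neg_cancel, add_zero]

/-- Products with elements of `𝔪 G` lie in `𝔪 G`. -/
lemma mul_mem_smul_top {e : G} (he : e ∈ maximalIdeal Λ • (⊤ : Submodule Λ G)) (a : G) :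
    X.mul e a ∈ maximalIdeal Λ • (⊤ : Submodule Λ G) := by
  induction he using Submodule.smul_induction_on' with
  | smul r hr z _ =>
    rw [map_smul, LinearMap.smul_apply]
    exact Submodule.smul_mem_smul hr trivial
  | add x _ z _ hx hz => rw [map_add, LinearMap.add_apply]; exact add_mem hx hz

end

end CurvedBVAlgebra

namespace CurvedBVAlgebra

/-! ### The curvature of an element of degree zero -/

section

variable {Λ : Type u} [CommRing Λ] [IsLocalRing Λ] {d : ℕ} {G : Type v} [AddCommGroup G]
  [Module Λ G] (X : CurvedBVAlgebra Λ d G) (A : Type*) [CommRing A] [Algebra Λ A]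

/-- The product on `A ⊗ G`. -/
abbrev mulA : A ⊗[Λ] G →ₗ[A] A ⊗[Λ] G →ₗ[A] A ⊗[Λ] G := LinearMap.BilinMap.baseChange A X.mul

/-- The bracket on `A ⊗ G`. -/
abbrev bracketA : A ⊗[Λ] G →ₗ[A] A ⊗[Λ] G →ₗ[A] A ⊗[Λ] G :=
  LinearMap.BilinMap.baseChange A X.bracket

variable {A}

lemma dcheck_mulA {a : A ⊗[Λ] G} (ha : a ∈ (X.tot 0).baseChange A) (x : A ⊗[Λ] G) :
    X.dcheck.baseChange A (X.mulA A a x) = X.mulA A a (X.dcheck.baseChange A x) +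
      (X.bracketA A a x + X.mulA A ((X.Del + X.dbar).baseChange A a) x) := by
  induction ha using BaseChange.induction_mem with
  | zero => simp
  | add a b _ _ ha hb => simp only [map_add, LinearMap.add_apply, ha, hb]; abel
  | tmul c a ha =>
  induction x using TensorProduct.induction_on with
  | zero => simp
  | add x y hx hy => simp only [map_add, hx, hy]; abel
  | tmul b x =>
    simp only [LinearMap.BilinMap.baseChange_tmul, LinearMap.baseChange_tmul, X.dcheck_mul ha,
      TensorProduct.tmul_add]

lemma bracketA_mulA {a b : A ⊗[Λ] G} (ha : a ∈ (X.tot 0).baseChange A)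
    (hb : b ∈ (X.tot 0).baseChange A) (x : A ⊗[Λ] G) :
    X.bracketA A a (X.mulA A b x) =
      X.mulA A (X.bracketA A a b) x + X.mulA A b (X.bracketA A a x) := by
  induction ha using BaseChange.induction_mem with
  | zero => simp
  | add a b _ _ ha hb => simp only [map_add, LinearMap.add_apply, ha, hb]; abel
  | tmul c a ha =>
  induction hb using BaseChange.induction_mem with
  | zero => simp
  | add a b _ _ ha hb => simp only [map_add, LinearMap.add_apply, ha, hb]; abel
  | tmul e b hb =>
  induction x using TensorProduct.induction_on with
  | zero => simp
  | add x y hx hy => simp only [map_add, hx, hy]; abel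
  | tmul f x =>
    simp only [LinearMap.BilinMap.baseChange_tmul, X.bracket_mul_tot ha hb,
      TensorProduct.tmul_add]
    rw [_root_.mul_assoc, _root_.mul_left_comm e]

lemma mulA_left_comm {a : A ⊗[Λ] G} (ha : a ∈ (X.tot 0).baseChange A) (x y : A ⊗[Λ] G) :
    X.mulA A x (X.mulA A a y) = X.mulA A a (X.mulA A x y) := by
  induction ha using BaseChange.induction_mem with
  | zero => simp
  | add a b _ _ ha hb => simp only [map_add, LinearMap.add_apply, ha, hb]
  | tmul c a ha =>
  induction x using TensorProduct.induction_on with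
  | zero => simp
  | add x y hx hy => simp only [map_add, LinearMap.add_apply, hx, hy]
  | tmul b x =>
  induction y using TensorProduct.induction_on with
  | zero => simp
  | add x y hx hy => simp only [map_add, hx, hy]
  | tmul e y =>
    simp only [LinearMap.BilinMap.baseChange_tmul, X.mul_left_comm ha]
    rw [_root_.mul_left_comm b]

lemma bracketA_comm {a b : A ⊗[Λ] G} (ha : a ∈ (X.tot 0).baseChange A)
    (hb : b ∈ (X.tot 0).baseChange A) : X.bracketA A a b = X.bracketA A b a := by
  induction ha using BaseChange.induction_mem with
  | zero => simp
  | add a b _ _ ha hb => simp only [map_add, LinearMap.add_apply, ha, hb]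
  | tmul c a ha =>
  induction hb using BaseChange.induction_mem with
  | zero => simp
  | add a b _ _ ha hb => simp only [map_add, LinearMap.add_apply, ha, hb]
  | tmul e b hb =>
    simp only [LinearMap.BilinMap.baseChange_tmul, X.bracket_comm ha hb]
    rw [_root_.mul_comm]

lemma bracketA_one {a : A ⊗[Λ] G} (ha : a ∈ (X.tot 0).baseChange A) :
    X.bracketA A a (1 ⊗ₜ X.one) = 0 := by
  induction ha using BaseChange.induction_mem with
  | zero => simp
  | add a b _ _ ha hb => simp only [map_add, LinearMap.add_apply, ha, hb, add_zero]
  | tmul c a ha =>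
    rw [LinearMap.BilinMap.baseChange_tmul, X.bracket_one ha, TensorProduct.tmul_zero]

lemma mulA_one (a : A ⊗[Λ] G) : X.mulA A a (1 ⊗ₜ X.one) = a := by
  induction a using TensorProduct.induction_on with
  | zero => simp
  | add a b ha hb => simp only [map_add, LinearMap.add_apply, ha, hb]
  | tmul c a => rw [LinearMap.BilinMap.baseChange_tmul, X.mul_one, _root_.mul_one]

lemma bracketA_zero_zero {q q' : ℤ} {a b : A ⊗[Λ] G} (ha : a ∈ (X.gr 0 q).baseChange A)
    (hb : b ∈ (X.gr 0 q').baseChange A) : X.bracketA A a b = 0 := by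
  have h := BaseChange.bilin_mem X.bracket (N := ⊥)
    (fun x hx y hy => by rw [X.bracket_zero_zero hx hy]; exact zero_mem _) ha hb
  rwa [Submodule.baseChange_bot, Submodule.mem_bot] at h

lemma DelA_eq_zero {q : ℤ} {a : A ⊗[Λ] G} (ha : a ∈ (X.gr 0 q).baseChange A) :
    X.Del.baseChange A a = 0 :=
  BaseChange.baseChange_eq_zero (fun _ hx => X.Del_eq_zero hx) ha

/-- The curvature `(Δ + ∂̄) a + ½ [a, a] + ℓ + y`; the first argument stands for `½`. -/
def curvature (half : Λ) (a : A ⊗[Λ] G) : A ⊗[Λ] G :=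
  (X.Del + X.dbar).baseChange A a + half • X.bracketA A a a + 1 ⊗ₜ (X.ell + X.y)

/-- If `a` annihilates its curvature `S`, then `ď(e^a) = S`. -/
lemma exists_dcheck_eq_curvature {c : ℕ → Λ} (hc0 : c 0 = 1)
    (hc : ∀ n, (n + 1 : ℕ) * c (n + 1) = c n) {half : Λ} (hhalf : 2 * half = 1)
    {a : A ⊗[Λ] G} (ha : a ∈ (X.tot 0).baseChange A) (hnil : IsNilpotent (X.mulA A a))
    (hS : X.mulA A a (X.curvature half a) = 0) :
    ∃ e ∈ (X.tot 0).baseChange A, X.dcheck.baseChange A e = X.curvature half a := by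
  -- Only the summand `[a, -]` of `U` fails to commute with `a ∧`; the Leibniz rule leaves `[a, a]
  -- ∧`.
  have hUT : ∀ x, X.bracketA A a (X.mulA A a x) +
      X.mulA A ((X.Del + X.dbar).baseChange A a) (X.mulA A a x) =
      X.mulA A a (X.bracketA A a x + X.mulA A ((X.Del + X.dbar).baseChange A a) x) +
        X.mulA A (X.bracketA A a a) x := fun x => by
    rw [X.bracketA_mulA ha ha, X.mulA_left_comm ha, map_add]; abel
  -- The operator identity is evaluated at the unit, where `ď1 = ℓ + y` and `[a, 1] = 0`; this
  -- produces exactly the curvature.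
  have hs : X.dcheck.baseChange A (1 ⊗ₜ X.one) + (X.bracketA A a (1 ⊗ₜ X.one) +
      X.mulA A ((X.Del + X.dbar).baseChange A a) (1 ⊗ₜ X.one)) +
      algebraMap Λ A half • X.mulA A (X.bracketA A a a) (1 ⊗ₜ X.one) = X.curvature half a := by
    rw [X.mulA_one, X.mulA_one, X.bracketA_one ha, LinearMap.baseChange_tmul, X.dcheck_one,
      algebraMap_smul, curvature]
    abel
  exact exists_apply_eq_of_commutators (D := X.dcheck.baseChange A) (T := X.mulA A a)
    (U := X.bracketA A a + X.mulA A ((X.Del + X.dbar).baseChange A a))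
    (W := X.mulA A (X.bracketA A a a)) (c := fun n => algebraMap Λ A (c n))
    (by simp [hc0]) (fun n => by simp [← hc n]) (half := algebraMap Λ A half)
    (by rw [← map_ofNat (algebraMap Λ A) 2, ← map_mul, hhalf, map_one])
    (X.dcheck_mulA ha) hUT (X.mulA_left_comm ha _) hnil
    (fun x hx => BaseChange.bilin_mem X.mul (fun x hx y hy => X.mul_mem_tot hx hy) ha hx)
    (Submodule.tmul_mem_baseChange_of_mem _ X.one_mem_tot) hs hS

end

end CurvedBVAlgebra

/-! ### Reduction to the residue field and base change of `ď`. -/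

lemma ArtAlg.toResidue_comp {k : Type w} {Λ : Type u} [Field k] [CommRing Λ] [Algebra k Λ]
    [IsLocalRing Λ] {A B : ArtAlg k Λ} (π : A.carrier →ₐ[Λ] B.carrier) :
    B.toResidue.comp π = A.toResidue := by
  ext a
  obtain ⟨r, hr⟩ := A.exists_algebraMap_sub_mem a
  have h1 := A.toResidue_eq_zero hr
  have h2 := B.toResidue_eq_zero (BaseChange.algHom_mem_maximalIdeal π hr)
  rw [map_sub, sub_eq_zero, AlgHom.commutes] at h1
  rw [map_sub, map_sub, sub_eq_zero, AlgHom.commutes, AlgHom.commutes] at h2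
  exact h2.trans h1.symm

lemma two_mul_algebraMap_half (k : Type w) (Λ : Type u) [Field k] [CharZero k] [CommRing Λ]
    [Algebra k Λ] : 2 * algebraMap k Λ (1 / 2) = 1 := by
  rw [← map_ofNat (algebraMap k Λ) 2, ← map_mul, mul_one_div_cancel two_ne_zero, map_one]

namespace CurvedBVAlgebra

variable {k : Type w} {Λ : Type u} [Field k] [CommRing Λ] [Algebra k Λ]
  [IsLocalRing Λ] {d : ℕ} {G : Type v} [AddCommGroup G] [Module Λ G] {X : CurvedBVAlgebra Λ d G}

lemma dcheckA_mem {A : Type*} [CommRing A] [Algebra Λ A] {n : ℤ} {x : A ⊗[Λ] G}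
    (hx : x ∈ (X.tot (n - 1)).baseChange A) :
    X.dcheck.baseChange A x ∈ (X.tot n).baseChange A :=
  BaseChange.baseChange_mem _ (fun _ hx => X.dcheck_mem_tot hx) hx

/-- `ℓ` and `y` have coefficients in `𝔪_Λ`, so over the residue field only `Δ + ∂̄` remains. This
links the cohomological condition (ii) to the double complex of condition (i). -/
lemma dcheck_residue (x : ResidueField Λ ⊗[Λ] G) :
    X.dcheck.baseChange (ResidueField Λ) x = X.filteredComplexZero.D x := by
  change _ = (X.Del + X.dbar).baseChange _ x
  rw [dcheck, LinearMap.baseChange_add, LinearMap.add_apply, add_eq_left]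
  induction x using TensorProduct.induction_on with
  | zero => simp
  | add x y hx hy => rw [map_add, hx, hy, add_zero]
  | tmul c a =>
    rw [LinearMap.baseChange_tmul]
    apply BaseChange.residue_tmul_eq_zero
    exact X.mul_mem_smul_top (add_mem (Submodule.smul_mono le_rfl le_top X.ell_mem)
      (Submodule.smul_mono le_rfl le_top X.y_mem)) a

lemma dcheckA_dcheckA {A : Type*} [CommRing A] [Algebra Λ A] {half : Λ} (hhalf : 2 * half = 1)
    (x : A ⊗[Λ] G) : X.dcheck.baseChange A (X.dcheck.baseChange A x) = 0 := by
  induction x using TensorProduct.induction_on with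
  | zero => simp
  | add x y hx hy => rw [map_add, map_add, hx, hy, add_zero]
  | tmul c a =>
    rw [LinearMap.baseChange_tmul, LinearMap.baseChange_tmul, X.dcheck_dcheck hhalf,
      TensorProduct.tmul_zero]

variable (X) in
lemma mem_gr_of_smallMap (A : ArtAlg k Λ) {ε : A.carrier} (hε : A.IsSmall ε) {p q : ℤ}
    {x : ResidueField Λ ⊗[Λ] G}
    (hx : BaseChange.smallMap A hε x ∈ (X.gr p q).baseChange A.carrier) :
    x ∈ (X.gr p q).baseChange (ResidueField Λ) := by
  have hflat : Module.Flat Λ G := X.flat_carrier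
  obtain ⟨f, h1, h2, -⟩ := X.exists_projection_gr p q
  exact BaseChange.mem_of_projection h1 h2 (BaseChange.smallMap_injective A hε) hx

variable (X) in
lemma mem_summand_of_smallMap (A : ArtAlg k Λ) {ε : A.carrier} (hε : A.IsSmall ε)
    (s : Set (ℤ × ℤ)) {x : ResidueField Λ ⊗[Λ] G}
    (hx : BaseChange.smallMap A hε x ∈ (⨆ i ∈ s, X.gr i.1 i.2).baseChange A.carrier) :
    x ∈ (⨆ i ∈ s, X.gr i.1 i.2).baseChange (ResidueField Λ) := by
  have hflat : Module.Flat Λ G := X.flat_carrier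
  obtain ⟨f, h1, h2, -⟩ := X.exists_projection s
  exact BaseChange.mem_of_projection h1 h2 (BaseChange.smallMap_injective A hε) hx

variable (X) in
lemma mem_tot_of_smallMap (A : ArtAlg k Λ) {ε : A.carrier} (hε : A.IsSmall ε) {n : ℤ}
    {x : ResidueField Λ ⊗[Λ] G}
    (hx : BaseChange.smallMap A hε x ∈ (X.tot n).baseChange A.carrier) :
    x ∈ (X.tot n).baseChange (ResidueField Λ) := by
  rw [X.tot_eq] at hx ⊢
  exact X.mem_summand_of_smallMap A hε _ hx

/-! ### Lifting of cocycles -/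

/-- Surjectivity on cohomology improves to surjectivity on cocycles: the discrepancy is a
coboundary, its primitive lifts to `A`, and subtracting `ď` of the lift keeps a cocycle because `ď²
= 0`. -/
lemma IsQuasiPerfect.exists_cocycle_lift_residue [CharZero k] (hX : X.IsQuasiPerfect k)
    (A : ArtAlg k Λ) {n : ℤ} {x : ResidueField Λ ⊗[Λ] G}
    (hx : x ∈ (X.tot n).baseChange (ResidueField Λ)) (hDx : X.dcheck.baseChange _ x = 0) :
    ∃ z ∈ (X.tot n).baseChange A.carrier, X.dcheck.baseChange _ z = 0 ∧
      BaseChange.map G A.toResidue z = x := by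
  obtain ⟨z, ⟨hz, hDz⟩, t, ht, htx⟩ :=
    Subquotient.exists_sub_mem_of_surjective (hX.2 A n) (x := x) ⟨hx, hDx⟩
  obtain ⟨s, hs, rfl⟩ := BaseChange.exists_lift_mem A.toResidue_surjective
    (show t ∈ (X.tot (n - 1)).baseChange _ from ht)
  refine ⟨z - X.dcheck.baseChange _ s, sub_mem hz (dcheckA_mem hs), ?_, ?_⟩
  · rw [map_sub, dcheckA_dcheckA (two_mul_algebraMap_half k Λ), sub_zero]
    exact hDz
  · rw [map_sub, BaseChange.map_baseChange, htx, sub_sub_cancel]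

/-- Cocycles lift along surjections of Artinian algebras. -/
theorem IsQuasiPerfect.exists_cocycle_lift [CharZero k] (hX : X.IsQuasiPerfect k) {n : ℤ}
    (A : ArtAlg k Λ) (B : ArtAlg k Λ) : ∀ (π : A.carrier →ₐ[Λ] B.carrier),
    Function.Surjective π → ∀ x ∈ (X.tot n).baseChange B.carrier, X.dcheck.baseChange _ x = 0 →
      ∃ z ∈ (X.tot n).baseChange A.carrier, X.dcheck.baseChange _ z = 0 ∧
        BaseChange.map G π z = x := by
  have hflat : Module.Flat Λ G := X.flat_carrier
  induction B using ArtAlg.smallInduction with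
  | h B ih =>
  intro π hπ x hx hDx
  by_cases hB : maximalIdeal B.carrier = ⊥
  · obtain ⟨z, hz, hDz, hzx⟩ := hX.exists_cocycle_lift_residue A
      (BaseChange.map_mem B.toResidue _ hx)
      (by rw [← BaseChange.map_baseChange, hDx, map_zero])
    refine ⟨z, hz, hDz, ?_⟩
    have hinj : Function.Injective (BaseChange.map G B.toResidue) :=
      Module.Flat.rTensor_preserves_injective_linearMap _ (B.toResidue_injective hB)
    apply hinj
    rw [BaseChange.map_map, ArtAlg.toResidue_comp π, hzx]
  -- Lift modulo `ε` first. The remaining error is `ε t`, and `t` is a cocycle over the residue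
  -- field since multiplication by `ε` is injective there. Lift `t` to a cocycle `s` over `A` and
  -- add `e s`, where `e` is any preimage of `ε`.
  · obtain ⟨ε, -, hε⟩ := B.exists_isSmall le_rfl hB
    obtain ⟨z, hz, hDz, hzx⟩ := ih ε hε ((B.toQuot ε hε.mem).comp π)
      ((B.toQuot_surjective ε hε.mem).comp hπ) (BaseChange.map G (B.toQuot ε hε.mem) x)
      (BaseChange.map_mem _ _ hx) (by rw [← BaseChange.map_baseChange, hDx, map_zero])
    have h1 : BaseChange.map G (B.toQuot ε hε.mem) (x - BaseChange.map G π z) = 0 := by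
      rw [map_sub, ← hzx, BaseChange.map_map, sub_self]
    obtain ⟨t, ht⟩ := BaseChange.exists_smallMap_eq B hε h1
    have ht' : t ∈ (X.tot n).baseChange (ResidueField Λ) := by
      refine X.mem_tot_of_smallMap B hε ?_
      rw [ht]
      exact sub_mem hx (BaseChange.map_mem π _ hz)
    have hDt : X.dcheck.baseChange _ t = 0 := by
      apply BaseChange.smallMap_injective B hε
      rw [BaseChange.smallMap_baseChange, ht, map_sub, hDx, ← BaseChange.map_baseChange, hDz,
        map_zero, map_zero, sub_zero]
    obtain ⟨s, hs, hDs, hst⟩ := hX.exists_cocycle_lift_residue A ht' hDt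
    obtain ⟨e, he⟩ := hπ ε
    refine ⟨z + e • s, add_mem hz (Submodule.smul_mem _ _ hs), ?_, ?_⟩
    · rw [map_add, _root_.map_smul, hDz, hDs, smul_zero, add_zero]
    · have h2 : BaseChange.map G B.toResidue (BaseChange.map G π s) = t := by
        rw [BaseChange.map_map, ArtAlg.toResidue_comp π, hst]
      rw [map_add, BaseChange.map_smul, he, ← BaseChange.smallMap_map_toResidue B hε, h2, ht]
      abel

end CurvedBVAlgebra

/-- Each application of the operator gains a factor of `m`: it maps `J (A ⊗ M)` into `m J (A ⊗ M)`.
-/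
lemma BaseChange.isNilpotent_bilin {Λ : Type u} [CommRing Λ] {M : Type v} [AddCommGroup M]
    [Module Λ M] {A : Type*} [CommRing A] [Algebra Λ A] {m : Ideal A} (hm : IsNilpotent m)
    (F : M →ₗ[Λ] M →ₗ[Λ] M) {N : Submodule A (A ⊗[Λ] M)} {a : A ⊗[Λ] M} (ha : a ∈ m • N) :
    IsNilpotent (R := Module.End A (A ⊗[Λ] M)) (LinearMap.BilinMap.baseChange A F a) := by
  obtain ⟨n, hn⟩ := hm
  set T : Module.End A (A ⊗[Λ] M) := LinearMap.BilinMap.baseChange A F a with hT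
  have h1 : ∀ (J : Ideal A) (x : A ⊗[Λ] M), x ∈ J • (⊤ : Submodule A (A ⊗[Λ] M)) →
      T x ∈ (m * J) • (⊤ : Submodule A (A ⊗[Λ] M)) := fun J x hx => by
    rw [hT, Submodule.mul_smul]
    clear hT T
    induction ha using Submodule.smul_induction_on' with
    | smul b hb y _ =>
      rw [_root_.map_smul, LinearMap.smul_apply]
      refine Submodule.smul_mem_smul hb ?_
      have h2 := Submodule.mem_map_of_mem (f := LinearMap.BilinMap.baseChange A F y) hx
      rw [Submodule.map_smul''] at h2
      exact Submodule.smul_mono le_rfl le_top h2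
    | add y _ z _ hy hz => rw [_root_.map_add, LinearMap.add_apply]; exact add_mem hy hz
  have h2 : ∀ (i : ℕ) (x : A ⊗[Λ] M), (T ^ i) x ∈ m ^ i • (⊤ : Submodule A (A ⊗[Λ] M)) := by
    intro i
    induction i with
    | zero => intro x; rw [pow_zero, Ideal.one_eq_top, Submodule.top_smul]; trivial
    | succ i ih => intro x; rw [pow_succ', pow_succ']; exact h1 _ _ (ih x)
  refine ⟨n, LinearMap.ext fun x => ?_⟩
  have h3 := h2 n x
  rwa [hn, Ideal.zero_eq_bot, Submodule.bot_smul, Submodule.mem_bot] at h3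

namespace CurvedBVAlgebra

variable {k : Type w} {Λ : Type u} [Field k] [CommRing Λ] [Algebra k Λ]
  [IsLocalRing Λ] {d : ℕ} {G : Type v} [AddCommGroup G] [Module Λ G] {X : CurvedBVAlgebra Λ d G}

/-! ### Strictness over the residue field -/

lemma gr_le_F {p q n r : ℤ} (h : p + q = n) (hr : r ≤ p) :
    (X.gr p q).baseChange (ResidueField Λ) ≤ X.filteredComplexZero.F r n :=
  Submodule.baseChange_mono _ (le_iSup₂_of_le (f := fun p' (_ : r ≤ p') => X.gr p' (n - p')) p hr
    (by rw [show n - p = q by omega]))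

lemma F_zero_le : X.filteredComplexZero.F 0 0 ≤ (X.gr 0 0).baseChange (ResidueField Λ) := by
  refine Submodule.baseChange_mono _ (iSup₂_le fun p hp => ?_)
  obtain rfl | h := eq_or_lt_of_le hp
  · exact le_rfl
  · rw [X.gr_eq_bot _ _ (by omega)]
    exact bot_le

/-- In total degree `0`, only the columns `p = -1` and `p = 0` remain. This is why a primitive in
`F^{-1}` splits into corrections of `φ` and of `f`. -/
lemma F_neg_one_le :
    X.filteredComplexZero.F (-1) 0 ≤ (X.gr (-1) 1 ⊔ X.gr 0 0).baseChange (ResidueField Λ) := by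
  refine Submodule.baseChange_mono _ (iSup₂_le fun p hp => ?_)
  obtain rfl | h := eq_or_lt_of_le hp
  · exact le_sup_left
  · obtain rfl | h := eq_or_lt_of_le (show 0 ≤ p by omega)
    · exact le_sup_right
    · rw [X.gr_eq_bot _ _ (by omega)]
      exact bot_le

lemma F_eq_bot {p n : ℤ} (hp : 0 < p) : X.filteredComplexZero.F p n = ⊥ := by
  have h : (⨆ (p' : ℤ) (_ : p ≤ p'), X.gr p' (n - p')) = ⊥ :=
    le_bot_iff.mp (iSup₂_le fun i hi => (X.gr_eq_bot _ _ (by omega)).le)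
  change Submodule.baseChange _ (⨆ (p' : ℤ) (_ : p ≤ p'), X.gr p' (n - p')) = ⊥
  rw [h, Submodule.baseChange_bot]

lemma tot_le_F {p n : ℤ} (hp : p ≤ -d) :
    (X.tot n).baseChange (ResidueField Λ) ≤ X.filteredComplexZero.F p n := by
  refine Submodule.baseChange_mono _ (iSup_le fun i => ?_)
  by_cases h : p ≤ i
  · exact le_iSup₂_of_le (f := fun p' (_ : p ≤ p') => X.gr p' (n - p')) i h le_rfl
  · rw [X.gr_eq_bot _ _ (by omega)]
    exact bot_le

lemma IsQuasiPerfect.exists_primitive (hX : X.IsQuasiPerfect k) {q : ℤ} (hq : -1 ≤ q)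
    (hq' : q ≤ 0) {x : ResidueField Λ ⊗[Λ] G} (hx : x ∈ (X.tot 0).baseChange (ResidueField Λ))
    (hDx : X.dcheck.baseChange _ x ∈ X.filteredComplexZero.F q 1) :
    ∃ z ∈ X.filteredComplexZero.F q 0, X.dcheck.baseChange _ z = X.dcheck.baseChange _ x := by
  rw [dcheck_residue] at hDx ⊢
  -- `2` suffices because `q + 2 > 0` lies beyond the last column, and `d` because `q - d ≤ -d`,
  -- where the filtration is everything.
  obtain ⟨z, hz, h⟩ := hX.1.exists_primitive (n := 0) (q := q) 2 (X.F_eq_bot (by omega)) d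
    (X.tot_le_F (by omega) hx) hDx
  exact ⟨z, hz, by rw [dcheck_residue, h]⟩

/-- The curvature of an element that is flat modulo a small element `ε` is exact. -/
lemma IsQuasiPerfect.exists_smallMap_dcheck_eq [CharZero k] (hX : X.IsQuasiPerfect k)
    (A : ArtAlg k Λ) {ε : A.carrier} (hε : A.IsSmall ε) {a : A.carrier ⊗[Λ] G}
    (ha : a ∈ maximalIdeal A.carrier • (X.tot 0).baseChange A.carrier)
    (hS : BaseChange.map G (A.toQuot ε hε.mem) (X.curvature (algebraMap k Λ (1 / 2)) a) = 0) :
    ∃ x ∈ (X.tot 0).baseChange (ResidueField Λ),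
      BaseChange.smallMap A hε (X.dcheck.baseChange _ x) =
        X.curvature (algebraMap k Λ (1 / 2)) a := by
  have hflat : Module.Flat Λ G := X.flat_carrier
  obtain ⟨s, hs⟩ := BaseChange.exists_smallMap_eq A hε hS
  -- `e` is the exponential of `a`, with coefficients `1 / n!`. The curvature is a multiple of `ε`,
  -- so `a`, having coefficients in `𝔪_A`, annihilates it.
  obtain ⟨e, he, hDe⟩ := X.exists_dcheck_eq_curvature
    (c := fun n => algebraMap k Λ ((n.factorial : k)⁻¹)) (by simp)
    (fun n => by
      rw [← map_natCast (algebraMap k Λ), ← map_mul, Nat.factorial_succ, Nat.cast_mul, mul_inv,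
        mul_inv_cancel_left₀ (Nat.cast_ne_zero.mpr n.succ_ne_zero)])
    (two_mul_algebraMap_half k Λ) (Submodule.smul_le_right ha)
    (BaseChange.isNilpotent_bilin A.isNilpotent_maximalIdeal X.mul ha)
    (by rw [← hs]; exact BaseChange.bilin_smallMap_right A hε X.mul ha s)
  -- The reduction of `e` modulo `ε` is a cocycle. Subtracting a cocycle `z` over `A` that lifts it
  -- changes nothing in `ď e`, but leaves a multiple of `ε`.
  obtain ⟨z, hz, hDz, hze⟩ := hX.exists_cocycle_lift A (A.quot ε hε.mem) (A.toQuot ε hε.mem)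
    (A.toQuot_surjective ε hε.mem) _ (BaseChange.map_mem (A.toQuot ε hε.mem) _ he)
    (by rw [← BaseChange.map_baseChange, hDe, hS])
  obtain ⟨x, hx⟩ := BaseChange.exists_smallMap_eq A hε (x := e - z)
    (by rw [map_sub, hze, sub_self])
  refine ⟨x, X.mem_tot_of_smallMap A hε (by rw [hx]; exact sub_mem he hz), ?_⟩
  rw [BaseChange.smallMap_baseChange, hx, map_sub, hDe, hDz, sub_zero]

/-! ### Maurer-Cartan elements -/

/-- The left hand side of the Maurer-Cartan equation; `half` stands for `½`. -/
def mcCurv {A : Type*} [CommRing A] [Algebra Λ A] (X : CurvedBVAlgebra Λ d G) (half : Λ)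
    (φ : A ⊗[Λ] G) : A ⊗[Λ] G :=
  X.dbar.baseChange A φ + half • X.bracketA A φ φ + 1 ⊗ₜ X.ell

/-- The left hand side of the second semi-classical Maurer-Cartan equation. -/
def smcCurv {A : Type*} [CommRing A] [Algebra Λ A] (X : CurvedBVAlgebra Λ d G)
    (φ f : A ⊗[Λ] G) : A ⊗[Λ] G :=
  X.dbar.baseChange A f + X.bracketA A φ f + 1 ⊗ₜ X.y + X.Del.baseChange A φ

lemma map_mcCurv {A B : Type*} [CommRing A] [Algebra Λ A] [CommRing B] [Algebra Λ B]
    (π : A →ₐ[Λ] B) (half : Λ) (φ : A ⊗[Λ] G) :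
    BaseChange.map G π (X.mcCurv half φ) = X.mcCurv half (BaseChange.map G π φ) := by
  rw [mcCurv, map_add, map_add, _root_.map_smul, BaseChange.map_baseChange, BaseChange.map_bilin]
  simp [BaseChange.map, mcCurv]

lemma map_smcCurv {A B : Type*} [CommRing A] [Algebra Λ A] [CommRing B] [Algebra Λ B]
    (π : A →ₐ[Λ] B) (φ f : A ⊗[Λ] G) :
    BaseChange.map G π (X.smcCurv φ f) =
      X.smcCurv (BaseChange.map G π φ) (BaseChange.map G π f) := by
  rw [smcCurv, map_add, map_add, map_add, BaseChange.map_baseChange, BaseChange.map_baseChange,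
    BaseChange.map_bilin]
  simp [BaseChange.map, smcCurv]

lemma mcCurv_mem {A : Type*} [CommRing A] [Algebra Λ A] (half : Λ) {φ : A ⊗[Λ] G}
    (hφ : φ ∈ (X.gr (-1) 1).baseChange A) : X.mcCurv half φ ∈ (X.gr (-1) 2).baseChange A := by
  have h1 : ∀ x ∈ X.gr (-1) 1, X.dbar x ∈ X.gr (-1) 2 := fun x hx => X.dbar_mem hx
  have h2 : ∀ x ∈ X.gr (-1) 1, ∀ y ∈ X.gr (-1) 1, X.bracket x y ∈ X.gr (-1) 2 :=
    fun x hx y hy => X.bracket_mem hx hy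
  exact add_mem (add_mem (BaseChange.baseChange_mem _ h1 hφ)
    (Submodule.smul_of_tower_mem _ half (BaseChange.bilin_mem X.bracket h2 hφ hφ)))
    (BaseChange.mem_baseChange_of_mem_smul X.ell_mem)

lemma smcCurv_mem {A : Type*} [CommRing A] [Algebra Λ A] {φ f : A ⊗[Λ] G}
    (hφ : φ ∈ (X.gr (-1) 1).baseChange A) (hf : f ∈ (X.gr 0 0).baseChange A) :
    X.smcCurv φ f ∈ (X.gr 0 1).baseChange A := by
  have h1 : ∀ x ∈ X.gr 0 0, X.dbar x ∈ X.gr 0 1 := fun x hx => X.dbar_mem hx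
  have h2 : ∀ x ∈ X.gr (-1) 1, ∀ y ∈ X.gr 0 0, X.bracket x y ∈ X.gr 0 1 :=
    fun x hx y hy => X.bracket_mem hx hy
  have h3 : ∀ x ∈ X.gr (-1) 1, X.Del x ∈ X.gr 0 1 := fun x hx => X.Del_mem hx
  exact add_mem (add_mem (add_mem (BaseChange.baseChange_mem _ h1 hf)
    (BaseChange.bilin_mem X.bracket h2 hφ hf))
    (BaseChange.mem_baseChange_of_mem_smul X.y_mem)) (BaseChange.baseChange_mem _ h3 hφ)

/-- `Δf` and `[f, f]` would have `p = 1`, hence vanish; the two equal cross terms of `[a, a]` cancel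
the factor `½`. -/
lemma curvature_add {A : Type*} [CommRing A] [Algebra Λ A] {half : Λ} (hhalf : 2 * half = 1)
    {φ f : A ⊗[Λ] G} (hφ : φ ∈ (X.gr (-1) 1).baseChange A) (hf : f ∈ (X.gr 0 0).baseChange A) :
    X.curvature half (φ + f) = X.mcCurv half φ + X.smcCurv φ f := by
  have hφ' := Submodule.baseChange_mono A (X.gr_le_tot (n := 0) (by norm_num)) hφ
  have hf' := Submodule.baseChange_mono A (X.gr_le_tot (n := 0) (by norm_num)) hf
  have h1 : X.bracketA A (φ + f) (φ + f) = X.bracketA A φ φ + (2 : Λ) • X.bracketA A φ f := by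
    simp only [map_add, LinearMap.add_apply]
    rw [X.bracketA_comm hf' hφ', X.bracketA_zero_zero hf hf, two_smul]
    abel
  rw [curvature, h1, smul_add, smul_smul, _root_.mul_comm half, hhalf, one_smul, map_add,
    LinearMap.baseChange_add, LinearMap.add_apply, LinearMap.add_apply, X.DelA_eq_zero hf,
    TensorProduct.tmul_add, mcCurv, smcCurv]
  abel

/-- Every bracket involving the correction vanishes, because `φ` and the correction both have
coefficients in `𝔪_A`; only the linear term `∂̄` sees it. -/
lemma mcCurv_sub_smallMap (A : ArtAlg k Λ) {ε : A.carrier} (hε : A.IsSmall ε) (half : Λ)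
    {N : Submodule A.carrier (A.carrier ⊗[Λ] G)} {φ : A.carrier ⊗[Λ] G}
    (hφ : φ ∈ maximalIdeal A.carrier • N) (ψ : ResidueField Λ ⊗[Λ] G) :
    X.mcCurv half (φ - BaseChange.smallMap A hε ψ) =
      X.mcCurv half φ - X.dbar.baseChange _ (BaseChange.smallMap A hε ψ) := by
  have hψ := BaseChange.smallMap_mem A hε (N := ⊤) (x := ψ)
    (by rw [Submodule.baseChange_top]; trivial)
  simp only [mcCurv, map_sub, LinearMap.sub_apply,
    BaseChange.bilin_smallMap_right A hε X.bracket hφ,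
    BaseChange.bilin_smallMap_right A hε X.bracket hψ,
    BaseChange.bilin_smallMap_left A hε X.bracket hφ, sub_zero]
  abel

lemma smcCurv_sub_smallMap (A : ArtAlg k Λ) {ε : A.carrier} (hε : A.IsSmall ε)
    {N N' : Submodule A.carrier (A.carrier ⊗[Λ] G)} {φ f : A.carrier ⊗[Λ] G}
    (hφ : φ ∈ maximalIdeal A.carrier • N) (hf : f ∈ maximalIdeal A.carrier • N')
    (ψ g : ResidueField Λ ⊗[Λ] G) :
    X.smcCurv (φ - BaseChange.smallMap A hε ψ) (f - BaseChange.smallMap A hε g) =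
      X.smcCurv φ f - (X.dbar.baseChange _ (BaseChange.smallMap A hε g) +
        X.Del.baseChange _ (BaseChange.smallMap A hε ψ)) := by
  have hψ := BaseChange.smallMap_mem A hε (N := ⊤) (x := ψ)
    (by rw [Submodule.baseChange_top]; trivial)
  simp only [smcCurv, map_sub, LinearMap.sub_apply,
    BaseChange.bilin_smallMap_right A hε X.bracket hφ,
    BaseChange.bilin_smallMap_right A hε X.bracket hψ,
    BaseChange.bilin_smallMap_left A hε X.bracket hf, sub_zero]
  abel

end CurvedBVAlgebra

namespace CurvedBVAlgebra

variable {k : Type w} {Λ : Type u} [Field k] [CommRing Λ] [Algebra k Λ]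
  [IsLocalRing Λ] {d : ℕ} {G : Type v} [AddCommGroup G] [Module Λ G] {X : CurvedBVAlgebra Λ d G}

lemma eq_and_eq_of_add_eq {A : Type*} [CommRing A] [Algebra Λ A] {p q p' q' : ℤ}
    (hne : (p', q') ≠ (p, q)) {x x' y y' : A ⊗[Λ] G} (hx : x ∈ (X.gr p q).baseChange A)
    (hx' : x' ∈ (X.gr p q).baseChange A) (hy : y ∈ (X.gr p' q').baseChange A)
    (hy' : y' ∈ (X.gr p' q').baseChange A) (h : x + y = x' + y') : x = x' ∧ y = y' := by
  obtain ⟨f, -, h1, h2⟩ := X.exists_projection_gr p q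
  have h3 := congrArg (f.baseChange A) h
  rw [map_add, map_add, BaseChange.baseChange_eq_self h1 hx, BaseChange.baseChange_eq_self h1 hx',
    BaseChange.baseChange_eq_zero (h2 p' q' hne) hy,
    BaseChange.baseChange_eq_zero (h2 p' q' hne) hy', add_zero, add_zero] at h3
  exact ⟨h3, by rwa [h3, add_right_inj] at h⟩

lemma smallMap_dcheck (A : ArtAlg k Λ) {ε : A.carrier} (hε : A.IsSmall ε)
    (x : ResidueField Λ ⊗[Λ] G) :
    BaseChange.smallMap A hε (X.dcheck.baseChange _ x) =
      X.Del.baseChange _ (BaseChange.smallMap A hε x) +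
        X.dbar.baseChange _ (BaseChange.smallMap A hε x) := by
  have h : X.dcheck.baseChange _ x = (X.Del + X.dbar).baseChange (ResidueField Λ) x :=
    dcheck_residue x
  rw [h, BaseChange.smallMap_baseChange, LinearMap.baseChange_add, LinearMap.add_apply]

/-! ### Obstructions to lifting along small extensions -/

section Small

variable [CharZero k] (hX : X.IsQuasiPerfect k) (A : ArtAlg k Λ) {ε : A.carrier}
  (hε : A.IsSmall ε) {φ f : A.carrier ⊗[Λ] G}
  (hφ : φ ∈ maximalIdeal A.carrier • (X.gr (-1) 1).baseChange A.carrier)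
  (hf : f ∈ maximalIdeal A.carrier • (X.gr 0 0).baseChange A.carrier)
  (h1 : BaseChange.map G (A.toQuot ε hε.mem) (X.mcCurv (algebraMap k Λ (1 / 2)) φ) = 0)
  (h2 : BaseChange.map G (A.toQuot ε hε.mem) (X.smcCurv φ f) = 0)

include hX hφ hf h1 h2

lemma exists_smallMap_dcheck_eq_mcCurv_add_smcCurv :
    ∃ x ∈ (X.tot 0).baseChange (ResidueField Λ),
      BaseChange.smallMap A hε (X.dcheck.baseChange _ x) =
        X.mcCurv (algebraMap k Λ (1 / 2)) φ + X.smcCurv φ f := by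
  have hc := curvature_add (two_mul_algebraMap_half k Λ) (Submodule.smul_le_right hφ)
    (Submodule.smul_le_right hf)
  rw [← hc]
  refine hX.exists_smallMap_dcheck_eq A hε ?_ (by rw [hc, map_add, h1, h2, add_zero])
  exact add_mem
    (Submodule.smul_mono le_rfl (Submodule.baseChange_mono _ (X.gr_le_tot (by norm_num))) hφ)
    (Submodule.smul_mono le_rfl (Submodule.baseChange_mono _ (X.gr_le_tot (by norm_num))) hf)

/-- The obstruction to lifting a semi-classical Maurer-Cartan solution vanishes. -/
theorem exists_smallMap_eq_mcCurv_smcCurv :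
    ∃ ψ ∈ (X.gr (-1) 1).baseChange (ResidueField Λ), ∃ g ∈ (X.gr 0 0).baseChange (ResidueField Λ),
      X.dbar.baseChange _ (BaseChange.smallMap A hε ψ) = X.mcCurv (algebraMap k Λ (1 / 2)) φ ∧
      X.dbar.baseChange _ (BaseChange.smallMap A hε g) +
        X.Del.baseChange _ (BaseChange.smallMap A hε ψ) = X.smcCurv φ f := by
  obtain ⟨x, hx, hDx⟩ := exists_smallMap_dcheck_eq_mcCurv_add_smcCurv hX A hε hφ hf h1 h2
  have hmc := mcCurv_mem (algebraMap k Λ (1 / 2)) (Submodule.smul_le_right hφ)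
  have hsmc := smcCurv_mem (Submodule.smul_le_right hφ) (Submodule.smul_le_right hf)
  have hF : (⨆ i ∈ ({(-1, 2), (0, 1)} : Set (ℤ × ℤ)), X.gr i.1 i.2).baseChange (ResidueField Λ) ≤
      X.filteredComplexZero.F (-1) 1 := by
    refine Submodule.baseChange_mono _ (iSup₂_le fun i hi => ?_)
    have hi' : i.1 + i.2 = 1 ∧ -1 ≤ i.1 := by
      rcases hi with rfl | rfl <;> norm_num
    exact le_iSup₂_of_le (f := fun p' (_ : (-1 : ℤ) ≤ p') => X.gr p' (1 - p')) i.1 hi'.2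
      (by rw [show 1 - i.1 = i.2 by omega])
  -- The obstruction lives in columns `-1` and `0`, so strictness replaces `x` by a primitive in
  -- `F^{-1}`.
  obtain ⟨v, hv, hDv⟩ := hX.exists_primitive le_rfl (by norm_num) hx (by
    refine hF (X.mem_summand_of_smallMap A hε _ ?_)
    rw [hDx]
    refine add_mem (Submodule.baseChange_mono _ ?_ hmc) (Submodule.baseChange_mono _ ?_ hsmc)
    · exact le_iSup₂_of_le (f := fun (i : ℤ × ℤ) (_ : i ∈ ({(-1, 2), (0, 1)} : Set (ℤ × ℤ))) =>
        X.gr i.1 i.2) (-1, 2) (by simp) le_rfl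
    · exact le_iSup₂_of_le (f := fun (i : ℤ × ℤ) (_ : i ∈ ({(-1, 2), (0, 1)} : Set (ℤ × ℤ))) =>
        X.gr i.1 i.2) (0, 1) (by simp) le_rfl)
  obtain ⟨ψ, hψ, g, hg, rfl⟩ := BaseChange.exists_add_of_mem_sup (X.F_neg_one_le hv)
  have hjψ := Submodule.smul_le_right (BaseChange.smallMap_mem A hε hψ)
  have hjg := Submodule.smul_le_right (BaseChange.smallMap_mem A hε hg)
  have h3 := congrArg (BaseChange.smallMap A hε) hDv
  have e1 : ∀ x ∈ X.gr (-1) 1, X.dbar x ∈ X.gr (-1) 2 := fun x hx => X.dbar_mem hx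
  have e2 : ∀ x ∈ X.gr 0 0, X.dbar x ∈ X.gr 0 1 := fun x hx => X.dbar_mem hx
  have e3 : ∀ x ∈ X.gr (-1) 1, X.Del x ∈ X.gr 0 1 := fun x hx => X.Del_mem hx
  refine ⟨ψ, hψ, g, hg, eq_and_eq_of_add_eq (X := X) (p := -1) (q := 2) (p' := 0) (q' := 1)
    (by simp) (BaseChange.baseChange_mem _ e1 hjψ) hmc
    (add_mem (BaseChange.baseChange_mem _ e2 hjg) (BaseChange.baseChange_mem _ e3 hjψ)) hsmc ?_⟩
  -- `Δg = 0` for degree reasons, so the two bidegree components are `∂̄ψ` and `∂̄g + Δψ`.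
  rw [hDx, smallMap_dcheck, map_add, map_add, map_add, X.DelA_eq_zero hjg] at h3
  rw [← h3]
  abel

/-- The obstruction to extending a Maurer-Cartan solution to a semi-classical one vanishes. -/
theorem exists_smallMap_eq_smcCurv (h0 : X.mcCurv (algebraMap k Λ (1 / 2)) φ = 0) :
    ∃ g ∈ (X.gr 0 0).baseChange (ResidueField Λ),
      X.dbar.baseChange _ (BaseChange.smallMap A hε g) = X.smcCurv φ f := by
  obtain ⟨x, hx, hDx⟩ := exists_smallMap_dcheck_eq_mcCurv_add_smcCurv hX A hε hφ hf h1 h2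
  rw [h0, zero_add] at hDx
  -- With the Maurer-Cartan equation already solved, the obstruction lies in column `0`; strictness
  -- at `q = 0` gives a primitive of bidegree `(0, 0)`, so `φ` needs no correction.
  obtain ⟨g, hg, hDg⟩ := hX.exists_primitive (q := 0) (by norm_num) le_rfl hx (by
    refine X.gr_le_F (p := 0) (q := 1) (by norm_num) le_rfl (X.mem_gr_of_smallMap A hε ?_)
    rw [hDx]
    exact smcCurv_mem (Submodule.smul_le_right hφ) (Submodule.smul_le_right hf))
  have hg' := X.F_zero_le hg
  have hjg := Submodule.smul_le_right (BaseChange.smallMap_mem A hε hg')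
  refine ⟨g, hg', ?_⟩
  have h3 := congrArg (BaseChange.smallMap A hε) hDg
  rwa [hDx, smallMap_dcheck, X.DelA_eq_zero hjg, zero_add] at h3

end Small

/-! ### Semi-classical Maurer-Cartan solutions -/

/-- Maurer-Cartan solutions extend to semi-classical ones. -/
theorem IsQuasiPerfect.exists_smcCurv_eq_zero [CharZero k] (hX : X.IsQuasiPerfect k)
    (A : ArtAlg k Λ) : ∀ φ ∈ maximalIdeal A.carrier • (X.gr (-1) 1).baseChange A.carrier,
      X.mcCurv (algebraMap k Λ (1 / 2)) φ = 0 →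
      ∃ f ∈ maximalIdeal A.carrier • (X.gr 0 0).baseChange A.carrier, X.smcCurv φ f = 0 := by
  induction A using ArtAlg.smallInduction with
  | h A ih =>
  intro φ hφ h0
  -- When `𝔪_A = 0`, both `φ` and the image of `y` vanish, so `f = 0` works.
  by_cases hA : maximalIdeal A.carrier = ⊥
  · rw [hA, Submodule.bot_smul, Submodule.mem_bot] at hφ
    refine ⟨0, zero_mem _, ?_⟩
    have hy := BaseChange.one_tmul_mem_smul A X.y_mem
    rw [hA, Submodule.bot_smul, Submodule.mem_bot] at hy
    simp [smcCurv, hφ, hy]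
  · obtain ⟨ε, -, hε⟩ := A.exists_isSmall le_rfl hA
    obtain ⟨f, hf, hφf⟩ := ih ε hε (BaseChange.map G (A.toQuot ε hε.mem) φ)
      (BaseChange.map_mem_maximalIdeal_smul _ _ hφ) (by rw [← map_mcCurv, h0, map_zero])
    obtain ⟨f, hf', rfl⟩ := BaseChange.exists_lift_mem_maximalIdeal_smul
      (A.toQuot_surjective ε hε.mem) hf
    rw [← map_smcCurv] at hφf
    obtain ⟨g, hg, hfg⟩ := exists_smallMap_eq_smcCurv hX A hε hφ hf'
      (by rw [h0, map_zero]) hφf h0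
    refine ⟨f - BaseChange.smallMap A hε g, sub_mem hf' (BaseChange.smallMap_mem A hε hg), ?_⟩
    -- Taking `ψ = 0` keeps `φ` fixed.
    have h3 := smcCurv_sub_smallMap (X := X) A hε hφ hf' 0 g
    rwa [map_zero, sub_zero, map_zero, add_zero, hfg, sub_self] at h3

/-- Semi-classical Maurer-Cartan solutions lift along surjections of Artinian algebras. -/
theorem IsQuasiPerfect.exists_lift_smc [CharZero k] (hX : X.IsQuasiPerfect k) {B : ArtAlg k Λ}
    {φ f : B.carrier ⊗[Λ] G}
    (hφ : φ ∈ maximalIdeal B.carrier • (X.gr (-1) 1).baseChange B.carrier)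
    (hf : f ∈ maximalIdeal B.carrier • (X.gr 0 0).baseChange B.carrier)
    (h1 : X.mcCurv (algebraMap k Λ (1 / 2)) φ = 0) (h2 : X.smcCurv φ f = 0) (A : ArtAlg k Λ) :
    ∀ π : A.carrier →ₐ[Λ] B.carrier, Function.Surjective π →
      ∃ φ' ∈ maximalIdeal A.carrier • (X.gr (-1) 1).baseChange A.carrier,
      ∃ f' ∈ maximalIdeal A.carrier • (X.gr 0 0).baseChange A.carrier,
        X.mcCurv (algebraMap k Λ (1 / 2)) φ' = 0 ∧ X.smcCurv φ' f' = 0 ∧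
          BaseChange.map G π φ' = φ ∧ BaseChange.map G π f' = f := by
  have hflat : Module.Flat Λ G := X.flat_carrier
  induction A using ArtAlg.smallInduction with
  | h A ih =>
  intro π hπ
  by_cases hker : RingHom.ker π = ⊥
  · obtain ⟨φ', hφ', rfl⟩ := BaseChange.exists_lift_mem_maximalIdeal_smul hπ hφ
    obtain ⟨f', hf', rfl⟩ := BaseChange.exists_lift_mem_maximalIdeal_smul hπ hf
    have hinj' : Function.Injective π := (RingHom.injective_iff_ker_eq_bot _).mpr hker
    have hinj : Function.Injective (BaseChange.map G π) :=
      Module.Flat.rTensor_preserves_injective_linearMap _ hinj'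
    refine ⟨φ', hφ', f', hf', hinj ?_, hinj ?_, rfl, rfl⟩
    · rw [map_mcCurv, h1, map_zero]
    · rw [map_smcCurv, h2, map_zero]
  -- Choosing `ε` in the kernel makes `π` factor through `A / (ε)`, where a lift exists by
  -- induction. The correction over `A` is a multiple of `ε`, hence invisible in `B`.
  · obtain ⟨ε, hεπ, hε⟩ := A.exists_isSmall
      (le_maximalIdeal (RingHom.ker_ne_top (π : A.carrier →+* B.carrier))) hker
    obtain ⟨π', rfl⟩ := ArtAlg.exists_comp_toQuot hε.mem π hεπ
    have hπ' : Function.Surjective π' := Function.Surjective.of_comp (g := A.toQuot ε hε.mem) hπ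
    obtain ⟨φ₁, hφ₁, f₁, hf₁, h3, h4, rfl, rfl⟩ := ih ε hε π' hπ'
    obtain ⟨φ', hφ', rfl⟩ := BaseChange.exists_lift_mem_maximalIdeal_smul
      (A.toQuot_surjective ε hε.mem) hφ₁
    obtain ⟨f', hf', rfl⟩ := BaseChange.exists_lift_mem_maximalIdeal_smul
      (A.toQuot_surjective ε hε.mem) hf₁
    rw [← map_mcCurv] at h3
    rw [← map_smcCurv] at h4
    obtain ⟨ψ, hψ, g, hg, h5, h6⟩ := exists_smallMap_eq_mcCurv_smcCurv hX A hε hφ' hf' h3 h4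
    refine ⟨φ' - BaseChange.smallMap A hε ψ, sub_mem hφ' (BaseChange.smallMap_mem A hε hψ),
      f' - BaseChange.smallMap A hε g, sub_mem hf' (BaseChange.smallMap_mem A hε hg),
      ?_, ?_, ?_, ?_⟩
    · rw [mcCurv_sub_smallMap A hε _ hφ', h5, sub_self]
    · rw [smcCurv_sub_smallMap A hε hφ' hf', h6, sub_self]
    · rw [← BaseChange.map_map, map_sub, BaseChange.map_toQuot_smallMap, sub_zero]
    · rw [← BaseChange.map_map, map_sub, BaseChange.map_toQuot_smallMap, sub_zero]

/-! ### The Lie algebra `L = G^{-1,•}` -/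

variable (X) in
/-- The inclusion `A ⊗ L → A ⊗ G`. -/
abbrev inclL (A : Type*) [CommRing A] [Algebra Λ A] : A ⊗[Λ] X.L →ₗ[A] A ⊗[Λ] G :=
  X.L.subtype.baseChange A

/-- `L` is a direct summand of `G`, so the inclusion has a left inverse that survives base change.
-/
lemma inclL_injective (A : Type*) [CommRing A] [Algebra Λ A] :
    Function.Injective (X.inclL A) := by
  obtain ⟨p, h1, h2, -⟩ := X.exists_projection {i | i.1 = -1}
  have hL : (⨆ i ∈ {i : ℤ × ℤ | i.1 = -1}, X.gr i.1 i.2) = X.L := by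
    refine le_antisymm (iSup₂_le fun i (hi : i.1 = -1) => ?_) (iSup_le fun q => ?_)
    · rw [hi]
      exact X.gr_le_L _
    · exact le_iSup₂_of_le (f := fun (i : ℤ × ℤ) (_ : i ∈ {i : ℤ × ℤ | i.1 = -1}) => X.gr i.1 i.2)
        (-1, q) rfl le_rfl
  rw [hL] at h1 h2
  refine Function.LeftInverse.injective (g := (p.codRestrict X.L h1).baseChange A) fun x => ?_
  induction x using TensorProduct.induction_on with
  | zero => simp
  | add x y hx hy => rw [map_add, map_add, hx, hy]
  | tmul c x =>
    rw [LinearMap.baseChange_tmul, LinearMap.baseChange_tmul]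
    congr 1
    exact Subtype.ext (h2 x.1 x.2)

lemma map_inclL {A B : Type*} [CommRing A] [Algebra Λ A] [CommRing B] [Algebra Λ B]
    (π : A →ₐ[Λ] B) (x : A ⊗[Λ] X.L) :
    BaseChange.map G π (X.inclL A x) = X.inclL B (BaseChange.map X.L π x) := by
  induction x using TensorProduct.induction_on with
  | zero => simp
  | add x y hx hy => simp only [map_add, hx, hy]
  | tmul c x => rfl

lemma inclL_mc {A : Type*} [CommRing A] [Algebra Λ A] (half : Λ) (x : A ⊗[Λ] X.L) :
    X.inclL A (X.lie.dbar.baseChange A x +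
      half • LinearMap.BilinMap.baseChange A X.lie.bracket x x + 1 ⊗ₜ X.lie.ell) =
      X.mcCurv half (X.inclL A x) := by
  have h1 : ∀ x, X.inclL A (X.lie.dbar.baseChange A x) = X.dbar.baseChange A (X.inclL A x) := by
    intro x
    induction x using TensorProduct.induction_on with
    | zero => simp
    | add x y hx hy => simp only [map_add, hx, hy]
    | tmul c x => rfl
  have h2 : ∀ x y, X.inclL A (LinearMap.BilinMap.baseChange A X.lie.bracket x y) =
      X.bracketA A (X.inclL A x) (X.inclL A y) := by
    intro x y
    induction x using TensorProduct.induction_on with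
    | zero => simp
    | add x y hx hy => simp only [map_add, LinearMap.add_apply, hx, hy]
    | tmul c x =>
      induction y using TensorProduct.induction_on with
      | zero => simp
      | add x y hx hy => simp only [map_add, hx, hy]
      | tmul b y => rfl
  rw [map_add, map_add, h1, LinearMap.map_smul_of_tower, h2]
  rfl

lemma map_inclL_smul_gr {A : Type*} [CommRing A] [Algebra Λ A] (I : Ideal A) (q : ℤ) :
    (I • (X.lie.gr q).baseChange A).map (X.inclL A) = I • (X.gr (-1) q).baseChange A := by
  rw [Submodule.map_smul'']
  congr 1
  refine le_antisymm ?_ fun x hx => ?_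
  · rintro _ ⟨x, hx, rfl⟩
    induction hx using BaseChange.induction_mem with
    | zero => simp
    | add x y _ _ hx hy => rw [map_add]; exact add_mem hx hy
    | tmul c n hn => exact Submodule.tmul_mem_baseChange_of_mem c hn
  · induction hx using BaseChange.induction_mem with
    | zero => exact zero_mem _
    | add x y _ _ hx hy => exact add_mem hx hy
    | tmul c n hn =>
      exact ⟨c ⊗ₜ ⟨n, X.gr_le_L q hn⟩, Submodule.tmul_mem_baseChange_of_mem c hn, rfl⟩

lemma mem_mcSet_iff {A : ArtAlg k Λ} {x : A.carrier ⊗[Λ] X.L} :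
    x ∈ X.lie.mcSet k A ↔
      X.inclL A.carrier x ∈ maximalIdeal A.carrier • (X.gr (-1) 1).baseChange A.carrier ∧
        X.mcCurv (algebraMap k Λ (1 / 2)) (X.inclL A.carrier x) = 0 := by
  rw [← inclL_mc, ← map_inclL_smul_gr, map_eq_zero_iff _ (inclL_injective A.carrier)]
  exact and_congr_left' ((inclL_injective A.carrier).mem_set_image (s := SetLike.coe _)).symm

end CurvedBVAlgebra

end

/-! ### The second abstract unobstructedness theorem. -/

theorem mainTheorem2 {k : Type w} [Field k] [CharZero k]
    {Λ : Type u} [CommRing Λ] [Algebra k Λ] [IsLocalRing Λ] [IsNoetherianRing Λ]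
    [IsAdicComplete (IsLocalRing.maximalIdeal Λ) Λ]
    (hres : Function.Bijective (algebraMap k (IsLocalRing.ResidueField Λ)))
    {d : ℕ} {G : Type v} [AddCommGroup G] [Module Λ G] {Ω : Type v'} [AddCommGroup Ω] [Module Λ Ω]
    (X : CurvedBVCalculus Λ d G Ω) (hX : X.toCurvedBVAlgebra.IsQuasiPerfect k) :
    IsUnobstructed (X.toCurvedBVAlgebra.lie.MC k) ∧
      ∀ (A : ArtAlg k Λ), ∀ φ ∈ X.toCurvedBVAlgebra.lie.mcSet k A,
        ∃ f, (X.toCurvedBVAlgebra.L.subtype.lTensor A.carrier φ, f) ∈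
          X.toCurvedBVAlgebra.smcSet k A := by
  refine ⟨fun B' B π hπ => ?_, fun A φ hφ => ?_⟩
  · rintro ⟨φ, hφ⟩
    obtain ⟨h1, h2⟩ := CurvedBVAlgebra.mem_mcSet_iff.mp hφ
    -- The auxiliary `f` makes the lifting result for pairs applicable; its lift `f'` is then
    -- discarded.
    obtain ⟨f, hf, h3⟩ := hX.exists_smcCurv_eq_zero B _ h1 h2
    obtain ⟨φ', hφ', f', -, h4, -, h5, -⟩ := hX.exists_lift_smc h1 hf h2 h3 B' π hπ
    have h6 := hφ'
    rw [← CurvedBVAlgebra.map_inclL_smul_gr] at h6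
    obtain ⟨ψ, hψ, rfl⟩ := h6
    refine ⟨⟨ψ, CurvedBVAlgebra.mem_mcSet_iff.mpr ⟨hφ', h4⟩⟩, Subtype.ext ?_⟩
    apply CurvedBVAlgebra.inclL_injective B.carrier
    rw [← h5, CurvedBVAlgebra.map_inclL]
    rfl
  · obtain ⟨h1, h2⟩ := CurvedBVAlgebra.mem_mcSet_iff.mp hφ
    obtain ⟨f, hf, h3⟩ := hX.exists_smcCurv_eq_zero A _ h1 h2
    exact ⟨f, h1, hf, h2, h3⟩
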